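/- **Setting.** Let $W=(\beta^1,\dots,\beta^N)^\top$ be a vector of independent standard Brownian motions on a probability space $(\Omega,\mathcal F,\mathbb P)$, let $A=-\mathrm{diag}(\lambda_1,\dots,\lambda_N)$ with all $\lambda_p>0$ and $Q=\mathrm{diag}(\sigma_1^2,\dots,\sigma_N^2)$ with all $\sigma_p^2>0$. Let $T>0$, let $f\colon[0,T]\to\mathbb R^N$ be continuous, let $B_0\colon[0,T]\times\mathbb R^N\to\mathbb R^N$ be bounded with $B_0(r,\cdot)$ continuous for every $r$, put $B=B_0-f$, and let $u_0\colon\mathbb R^N\to\mathbb R$ be bounded and Borel measurable. Let $\mathbb S$ be the set of strictly increasing càdlàg functions $\ell\colon\mathbb R_+\to\mathbb R$ with $\ell_0=0$. For $\ell\in\mathbb S$, $0\le a<T$ and $x\in\mathbb R^N$ let $(Z^\ell_r(a,x))_{r\in[a,T]}$ be the càdlàg solution of $$dZ^\ell_r(a,x)=\big(AZ^\ell_r(a,x)+f(r)\big)dr+\sqrt Q\,dW_{\ell_r},\qquad Z^\ell_a(a,x)=x,$$ and for $0\le a<b\le T$ let $$F_{a,b}=\int_a^b e^{(b-r)A}f(r)\,dr,\qquad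 I^\ell_{a,b}=\int_{(a,b]}e^{2(b-r)A}Q\,d\ell_r\in\mathbb R^{N\times N}.$$ **Iterated functions.** Let $n\ge1$ be an integer and $t\in(0,T]$. For $0\le s_{n+1}<t$ and $\ell^0\in\mathbb S$ put $$k^{\ell^0}_{s_{n+1},t}(y)=\big\langle B(s_{n+1},y),\nabla_y\,\mathbb E\big[u_0\big(Z^{\ell^0}_t(s_{n+1},y)\big)\big]\big\rangle,\qquad y\in\mathbb R^N,$$ and for $1\le i\le n$, $0\le s_{n-i+1}<\dots<s_{n+1}<t$ and $\ell^0,\dots,\ell^i\in\mathbb S$ put $$k^{\ell^0,\dots,\ell^i}_{s_{n-i+1},\dots,s_{n+1},t}(y)=\Big\langle B(s_{n-i+1},y),\nabla_y\,\mathbb E\Big[k^{\ell^0,\dots,\ell^{i-1}}_{s_{n-i+2},\dots,s_{n+1},t}\big(Z^{\ell^i}_{s_{n-i+2}}(s_{n-i+1},y)\big)\Big]\Big\rangle,\qquad y\in\mathbb R^N.$$ **Lemma.** Let $0\le s<t\le T$ and let $n\ge1$ be an integer. Let $x\in\mathbb R^N$, $i\in\{0,\dots,n\}$, $s\le s_{n-i}<s_{n-i+1}<\dots<s_{n+1}<t$,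 $s_{n+2}=t$, and $\ell^0,\dots,\ell^{i+1}\in\mathbb S$. For $j=0,\dots,i+1$ write $\tau_j=s_{n+2-j}$, so that $\tau_0=t$ and $\tau_{i+1}=s_{n-i+1}$; write $Z_r=Z^{\ell^{i+1}}_r(s_{n-i},x)$, and put $$G_j=\big(I^{\ell^{i+1}}_{\tau_j,\tau_{j-1}}\big)^{-\frac12}\big(Z_{\tau_{j-1}}-e^{(\tau_{j-1}-\tau_j)A}Z_{\tau_j}-F_{\tau_j,\tau_{j-1}}\big),\qquad j=1,\dots,i+1,$$ $$Y_j=\sum_{k=j+1}^{i+1}e^{(\tau_j-\tau_{k-1})A}\Big[F_{\tau_k,\tau_{k-1}}+\big(I^{\ell^{k-1}}_{\tau_k,\tau_{k-1}}\big)^{\frac12}G_k\Big]+e^{(\tau_j-\tau_{i+1})A}Z_{\tau_{i+1}},\qquad j=0,\dots,i+1,$$ where an empty sum is $0$. Then the expectations and gradients in the definition of $k^{\ell^0,\dots,\ell^i}_{s_{n-i+1},\dots,s_{n+1},t}$ exist, the random variable in the conditional expectation below is integrable, and, $\mathbb P$-a.s., $$k^{\ell^0,\dots,\ell^i}_{s_{n-i+1},\dots,s_{n+1},t}\big(Z_{s_{n-i+1}}\big)=\mathbb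 E\Big[u_0(Y_0)\prod_{j=1}^{i+1}\Big\langle\big(I^{\ell^{j-1}}_{\tau_j,\tau_{j-1}}\big)^{-\frac12}e^{(\tau_{j-1}-\tau_j)A}B(\tau_j,Y_j),\,G_j\Big\rangle\;\Big|\;\sigma\big(Z_{s_{n-i+1}}\big)\Big].$$ -/

import Mathlib

open MeasureTheory ProbabilityTheory Set Filter Topology
open scoped NNReal RealInnerProductSpace MatrixOrder

noncomputable section

namespace OUIter

/-- A function that is right-continuous and has left limits at every point of `S`,
relative to `S`. -/
def IsCadlagOn {X F : Type*} [TopologicalSpace X] [Preorder X] [TopologicalSpace F]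
    (g : X → F) (S : Set X) : Prop :=
  ∀ t ∈ S, ContinuousWithinAt g (S ∩ Ici t) t ∧ ∃ l : F, Tendsto g (𝓝[S ∩ Iio t] t) (𝓝 l)

/-- The set `𝕊` of real-valued, strictly increasing càdlàg functions on `ℝ₊` starting at `0`. -/
structure TimeChange where
  toFun : ℝ≥0 → ℝ
  strictMono : StrictMono toFun
  cadlag : IsCadlagOn toFun univ
  map_zero : toFun 0 = 0

/-- The time change extended to `ℝ` by `0` on the negative half-line, as a Stieltjes function:
`ℓ.stieltjes.measure` is the Lebesgue-Stieltjes measure `dℓ`. -/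
def TimeChange.stieltjes (ℓ : TimeChange) : StieltjesFunction ℝ where
  toFun r := ℓ.toFun r.toNNReal
  mono' _ _ h := ℓ.strictMono.monotone (Real.toNNReal_le_toNNReal h)
  right_continuous' r := by
    have h := (ℓ.cadlag r.toNNReal (mem_univ _)).1
    exact h.comp (by fun_prop : Continuous Real.toNNReal).continuousWithinAt
      fun _ hy => ⟨mem_univ _, Real.toNNReal_le_toNNReal hy⟩

variable {N : ℕ}

/-- The action of an `N × N` matrix on `ℝ^N` with its Euclidean structure. -/
def act (M : Matrix (Fin N) (Fin N) ℝ) (x : EuclideanSpace ℝ (Fin N)) :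
    EuclideanSpace ℝ (Fin N) :=
  WithLp.toLp 2 (Matrix.mulVec M x.ofLp)

/-- The matrix `e^{rA}`. -/
def expMat (A : Matrix (Fin N) (Fin N) ℝ) (r : ℝ) : Matrix (Fin N) (Fin N) ℝ :=
  NormedSpace.exp (r • A)

/-- `M^{1/2}`, for a positive semidefinite `M`. -/
def sqrtMat (M : Matrix (Fin N) (Fin N) ℝ) : Matrix (Fin N) (Fin N) ℝ :=
  CFC.sqrt M

/-- `M^{-1/2}`, for a positive definite `M`. -/
def invSqrtMat (M : Matrix (Fin N) (Fin N) ℝ) : Matrix (Fin N) (Fin N) ℝ :=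
  (sqrtMat M)⁻¹

/-- `F_{a,b} = ∫_a^b e^{(b-r)A} f(r) dr`. -/
def driftInt (A : Matrix (Fin N) (Fin N) ℝ) (f : ℝ → EuclideanSpace ℝ (Fin N)) (a b : ℝ) :
    EuclideanSpace ℝ (Fin N) :=
  ∫ r in a..b, act (expMat A (b - r)) (f r)

/-- `I^ℓ_{a,b} = ∫_a^b e^{2(b-r)A} Q dℓ_r`, a Lebesgue-Stieltjes integral over `(a, b]`,
taken entry by entry. -/
def covMat (A Q : Matrix (Fin N) (Fin N) ℝ) (ℓ : TimeChange) (a b : ℝ) :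
    Matrix (Fin N) (Fin N) ℝ :=
  Matrix.of fun p q => ∫ r in Ioc a b, (expMat A (2 * (b - r)) * Q) p q ∂ℓ.stieltjes.measure

variable {Ω : Type*} [MeasurableSpace Ω]

/-- `W = (β^1, …, β^N)ᵀ`, where `β^1, …, β^N` are independent standard Brownian motions. -/
structure IsBrownianVector (W : ℝ≥0 → Ω → EuclideanSpace ℝ (Fin N)) (P : Measure Ω) : Prop where
  measurable : ∀ r, Measurable (W r)
  brownian : ∀ p : Fin N, IsBrownianReal (fun r ω => W r ω p) P
  indep : iIndepFun (fun (p : Fin N) (ω : Ω) (r : ℝ≥0) => W r ω p) P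

/-- `z = (z_t)`, `t ∈ [a,T]`, is the càdlàg solution of the linear stochastic differential equation
`dz_t = (A z_t + f(t)) dt + √Q dW_{ℓ_t}`, `z_a = x`. As the noise is additive, the equation in
integral form needs no stochastic integral. -/
structure IsOUProcess (A Q : Matrix (Fin N) (Fin N) ℝ) (f : ℝ → EuclideanSpace ℝ (Fin N)) (T : ℝ)
    (W : ℝ≥0 → Ω → EuclideanSpace ℝ (Fin N)) (P : Measure Ω) (ℓ : TimeChange) (a : ℝ)
    (x : EuclideanSpace ℝ (Fin N)) (z : ℝ → Ω → EuclideanSpace ℝ (Fin N)) : Prop where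
  measurable : ∀ t ∈ Icc a T, Measurable (z t)
  cadlag : ∀ᵐ ω ∂P, IsCadlagOn (fun t => z t ω) (Icc a T)
  eqn : ∀ᵐ ω ∂P, ∀ t ∈ Icc a T,
    z t ω = x + (∫ r in a..t, (act A (z r ω) + f r))
      + act (sqrtMat Q) (W (ℓ.toFun t.toNNReal).toNNReal ω - W (ℓ.toFun a.toNNReal).toNNReal ω)

/-- The iterated functions, for times listed backwards, `τ 0 > τ 1 > ⋯ ≥ 0`. Here `Z ℓ a y` is
the Ornstein-Uhlenbeck process with time change `ℓ` that starts from `y` at time `a`.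
`kIter 0 = u₀` and `kIter (m + 1) y = ⟨B(τ_{m+1}, y), ∇ E[kIter m (Z^{ℓ^m}_{τ_m}(τ_{m+1}, y))]⟩`,
so that `kIter (i + 1)` is the function `k^{ℓ^0,…,ℓ^i}_{τ_{i+1},…,τ_1,τ_0}`. -/
def kIter (P : Measure Ω)
    (Z : TimeChange → ℝ → EuclideanSpace ℝ (Fin N) → ℝ → Ω → EuclideanSpace ℝ (Fin N))
    (B : ℝ → EuclideanSpace ℝ (Fin N) → EuclideanSpace ℝ (Fin N))
    (u₀ : EuclideanSpace ℝ (Fin N) → ℝ) (ℓ : ℕ → TimeChange) (τ : ℕ → ℝ) :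
    ℕ → EuclideanSpace ℝ (Fin N) → ℝ
  | 0 => u₀
  | m + 1 => fun y =>
      ⟪B (τ (m + 1)) y,
        gradient (fun y' => ∫ ω, kIter P Z B u₀ ℓ τ m (Z (ℓ m) (τ (m + 1)) y' (τ m) ω) ∂P) y⟫

/-- `(I^ℓ_{a,b})^{-1/2} (ζ_b - e^{(b-a)A} ζ_a - F_{a,b})`, for a path `ζ`. -/
def normIncr (A Q : Matrix (Fin N) (Fin N) ℝ) (f : ℝ → EuclideanSpace ℝ (Fin N)) (ℓ : TimeChange)
    (ζ : ℝ → EuclideanSpace ℝ (Fin N)) (a b : ℝ) : EuclideanSpace ℝ (Fin N) :=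
  act (invSqrtMat (covMat A Q ℓ a b)) (ζ b - act (expMat A (b - a)) (ζ a) - driftInt A f a b)

/-- For a path `ζ`, and times listed backwards,
`∑_{k=j+1}^{m} e^{(τ_j-τ_{k-1})A} [F_{τ_k,τ_{k-1}} + (I^{ℓ^{k-1}}_{τ_k,τ_{k-1}})^{1/2}
  (I^{ℓ^m}_{τ_k,τ_{k-1}})^{-1/2} (ζ_{τ_{k-1}} - e^{(τ_{k-1}-τ_k)A} ζ_{τ_k} - F_{τ_k,τ_{k-1}})]
  + e^{(τ_j-τ_m)A} ζ_{τ_m}`. -/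
def rescaledState (A Q : Matrix (Fin N) (Fin N) ℝ) (f : ℝ → EuclideanSpace ℝ (Fin N))
    (ℓ : ℕ → TimeChange) (τ : ℕ → ℝ) (m : ℕ) (ζ : ℝ → EuclideanSpace ℝ (Fin N)) (j : ℕ) :
    EuclideanSpace ℝ (Fin N) :=
  (∑ k ∈ Finset.Icc (j + 1) m,
    act (expMat A (τ j - τ (k - 1)))
      (driftInt A f (τ k) (τ (k - 1))
        + act (sqrtMat (covMat A Q (ℓ (k - 1)) (τ k) (τ (k - 1))))
            (normIncr A Q f (ℓ m) ζ (τ k) (τ (k - 1)))))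
  + act (expMat A (τ j - τ m)) (ζ (τ m))

end OUIter

end

/-!
Integrating the linear equation by parts, as a limit of Riemann–Stieltjes sums, turns
`Z_b - e^{(b-a)A} Z_a - F_{a,b}` into a limit of linear combinations of Brownian increments, whose
characteristic functions converge to that of the Gaussian law with covariance `I^ℓ_{a,b}`. Done
jointly for all the intervals of a partition, this shows that the normalised increments `G_j` are
independent standard Gaussian vectors, whatever the time change is.

Hence the passage from time `a` to time `b` averages over an affine image
`e^{(b-a)A} y + F_{a,b} + (I^ℓ_{a,b})^{1/2} g` of Gaussian noise `g`. Shifting the derivative onto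
the Gaussian density shows that the gradient in `y` of such an average exists and is paired with a
vector `v` by inserting the weight `⟨(I^ℓ_{a,b})^{-1/2} e^{(b-a)A} v, g⟩`. By induction, `k` at the
point `y` is the mean of `u₀` times a product of such weights along the chain started from `y` and
driven by independent Gaussian vectors. The right-hand side of the claim is the same functional of
`y = Z_{τ_{i+1}}` and of the noise `G_1, …, G_{i+1}`, which is independent of `Z_{τ_{i+1}}` and has
the same law, so conditioning on `Z_{τ_{i+1}}` integrates the noise out.
-/

noncomputable section

namespace OUIter

section RiemannStieltjes

/-- The `l`-th point of the uniform grid of `[a, b]` with `n` cells. -/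
def gridPt (a b : ℝ) (n l : ℕ) : ℝ := a + l * ((b - a) / n)

/-- The number of the grid cell `(gridPt a b n (l - 1), gridPt a b n l]` that contains `r`. -/
def gridIdx (a b : ℝ) (n : ℕ) (r : ℝ) : ℕ := ⌈(r - a) / ((b - a) / n)⌉₊

/-- The Riemann-Stieltjes sum of `g` against `w` on the uniform grid of `[a, b]` with `n` cells,
with `g` evaluated at left endpoints. -/
def riemannStieltjesSum (g w : ℝ → ℝ) (a b : ℝ) (n : ℕ) : ℝ :=
  ∑ l ∈ Finset.range n, g (gridPt a b n l) * (w (gridPt a b n (l + 1)) - w (gridPt a b n l))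

variable {a b r : ℝ} {n l : ℕ}

lemma gridPt_zero (a b : ℝ) (n : ℕ) : gridPt a b n 0 = a := by simp [gridPt]

lemma gridPt_self (hn : n ≠ 0) : gridPt a b n n = b := by
  have : (n : ℝ) ≠ 0 := Nat.cast_ne_zero.2 hn
  unfold gridPt; field_simp; ring

lemma gridPt_mono (hab : a ≤ b) (n : ℕ) : Monotone (gridPt a b n) := by
  intro l m hlm
  have : 0 ≤ (b - a) / n := div_nonneg (sub_nonneg.2 hab) n.cast_nonneg
  unfold gridPt; gcongr

lemma gridPt_mem_Icc (hab : a ≤ b) (hn : n ≠ 0) (hl : l ≤ n) : gridPt a b n l ∈ Icc a b := by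
  constructor
  · simpa only [gridPt_zero] using gridPt_mono hab n l.zero_le
  · simpa only [gridPt_self hn] using gridPt_mono hab n hl

lemma gridIdx_eq_succ (hab : a < b) (hn : n ≠ 0)
    (hr : r ∈ Ioc (gridPt a b n l) (gridPt a b n (l + 1))) : gridIdx a b n r = l + 1 := by
  have hd : 0 < (b - a) / n := div_pos (sub_pos.2 hab) (by positivity)
  simp only [gridPt, mem_Ioc] at hr
  rw [gridIdx, Nat.ceil_eq_iff l.succ_ne_zero, lt_div_iff₀ hd, div_le_iff₀ hd]
  constructor
  · simpa using by linarith
  · linarith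

lemma gridIdx_le (hab : a < b) (hn : n ≠ 0) (hr : r ≤ b) : gridIdx a b n r ≤ n := by
  have hd : 0 < (b - a) / n := div_pos (sub_pos.2 hab) (by positivity)
  rw [gridIdx, Nat.ceil_le, div_le_iff₀ hd, mul_div_cancel₀ _ (Nat.cast_ne_zero.2 hn)]
  linarith

lemma le_gridPt_gridIdx (hab : a < b) (hn : n ≠ 0) (r : ℝ) :
    r ≤ gridPt a b n (gridIdx a b n r) := by
  have hd : 0 < (b - a) / n := div_pos (sub_pos.2 hab) (by positivity)
  have := (div_le_iff₀ hd).1 (Nat.le_ceil ((r - a) / ((b - a) / n)))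
  unfold gridPt gridIdx; linarith

lemma gridPt_gridIdx_le (hab : a < b) (hn : n ≠ 0) (hr : a ≤ r) :
    gridPt a b n (gridIdx a b n r) ≤ r + (b - a) / n := by
  have hd : 0 < (b - a) / n := div_pos (sub_pos.2 hab) (by positivity)
  have := mul_le_mul_of_nonneg_right
    (Nat.ceil_lt_add_one (div_nonneg (sub_nonneg.2 hr) hd.le)).le hd.le
  rw [add_mul, div_mul_cancel₀ _ hd.ne'] at this
  unfold gridPt gridIdx; linarith

lemma tendsto_gridPt_gridIdx (hab : a < b) (hr : r ∈ Icc a b) :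
    Tendsto (fun n => gridPt a b n (gridIdx a b n r)) atTop (𝓝[Icc a b ∩ Ici r] r) := by
  have hwidth : Tendsto (fun n : ℕ => r + (b - a) / n) atTop (𝓝 r) := by
    simpa using tendsto_const_nhds.add (tendsto_const_div_atTop_nhds_zero_nat (b - a))
  refine tendsto_nhdsWithin_iff.2 ⟨?_, ?_⟩
  · refine tendsto_of_tendsto_of_tendsto_of_le_of_le' tendsto_const_nhds hwidth ?_ ?_ <;>
      filter_upwards [eventually_ne_atTop 0] with n hn
    · exact le_gridPt_gridIdx hab hn r
    · exact gridPt_gridIdx_le hab hn hr.1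
  · filter_upwards [eventually_ne_atTop 0] with n hn
    exact ⟨gridPt_mem_Icc hab.le hn (gridIdx_le hab hn hr.2), le_gridPt_gridIdx hab hn r⟩

lemma tendsto_gridPt_gridIdx_sub_one (hab : a < b) (hr : r ∈ Ioc a b) :
    Tendsto (fun n => gridPt a b n (gridIdx a b n r - 1)) atTop (𝓝 r) := by
  have hright := (tendsto_gridPt_gridIdx hab (Ioc_subset_Icc_self hr)).mono_right
    nhdsWithin_le_nhds
  have := hright.sub (tendsto_const_div_atTop_nhds_zero_nat (b - a))
  rw [sub_zero] at this
  refine this.congr' ?_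
  filter_upwards [eventually_ne_atTop 0] with n hn
  have hd : 0 < (b - a) / n := div_pos (sub_pos.2 hab) (by positivity)
  have hpos : 1 ≤ gridIdx a b n r := Nat.ceil_pos.2 (div_pos (sub_pos.2 hr.1) hd)
  rw [gridPt, gridPt, Nat.cast_sub hpos]
  push_cast
  ring

lemma measurable_comp_gridIdx {F : Type*} [MeasurableSpace F] (a b : ℝ) (n : ℕ) (φ : ℕ → F) :
    Measurable fun r => φ (gridIdx a b n r) :=
  (measurable_from_top : Measurable φ).comp (Nat.measurable_ceil.comp (by fun_prop))

lemma sum_integral_gridCell {μ : Measure ℝ} (hab : a < b) (hn : n ≠ 0) {φ : ℕ → ℝ → ℝ}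
    (hφ : ∀ l c d, IntervalIntegrable (φ l) μ c d) :
    ∑ l ∈ Finset.range n, ∫ r in gridPt a b n l..gridPt a b n (l + 1), φ (l + 1) r ∂μ
      = ∫ r in a..b, φ (gridIdx a b n r) r ∂μ := by
  have hcell : ∀ l, EqOn (fun r => φ (gridIdx a b n r) r) (φ (l + 1))
      (uIoc (gridPt a b n l) (gridPt a b n (l + 1))) := fun l r hr => by
    rw [uIoc_of_le (gridPt_mono hab.le n l.le_succ)] at hr
    simp only [gridIdx_eq_succ hab hn hr]
  have hadj := intervalIntegral.sum_integral_adjacent_intervals (n := n) (a := gridPt a b n)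
    (f := fun r => φ (gridIdx a b n r) r) (μ := μ)
    fun l _ => (hφ (l + 1) _ _).congr fun r hr => (hcell l hr).symm
  rw [gridPt_zero, gridPt_self hn] at hadj
  rw [← hadj]
  exact Finset.sum_congr rfl fun l _ =>
    (intervalIntegral.integral_congr_ae (Eventually.of_forall fun r hr => hcell l hr)).symm

lemma riemannStieltjesSum_stieltjes (hab : a < b) (hn : n ≠ 0) (g : ℝ → ℝ)
    (L : StieltjesFunction ℝ) :
    riemannStieltjesSum g L a b n
      = ∫ r in a..b, g (gridPt a b n (gridIdx a b n r - 1)) ∂L.measure := by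
  rw [← sum_integral_gridCell (φ := fun l _ => g (gridPt a b n (l - 1))) hab hn
    fun _ _ _ => intervalIntegrable_const]
  refine Finset.sum_congr rfl fun l _ => ?_
  have hle := gridPt_mono hab.le n l.le_succ
  rw [intervalIntegral.integral_of_le hle, setIntegral_const, measureReal_def, L.measure_Ioc,
    ENNReal.toReal_ofReal (sub_nonneg.2 (L.mono hle)), smul_eq_mul, mul_comm, Nat.add_sub_cancel]

theorem tendsto_riemannStieltjesSum_stieltjes (hab : a < b) {g : ℝ → ℝ} (hg : Continuous g)
    (L : StieltjesFunction ℝ) :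
    Tendsto (riemannStieltjesSum g L a b) atTop (𝓝 (∫ r in Ioc a b, g r ∂L.measure)) := by
  obtain ⟨C, hC⟩ := isCompact_Icc.exists_bound_of_continuousOn (s := Icc a b) hg.continuousOn
  rw [← intervalIntegral.integral_of_le hab.le]
  have hlim : Tendsto (fun n => ∫ r in a..b, g (gridPt a b n (gridIdx a b n r - 1)) ∂L.measure)
      atTop (𝓝 (∫ r in a..b, g r ∂L.measure)) := by
    refine intervalIntegral.tendsto_integral_filter_of_dominated_convergence (fun _ => C)
      (Eventually.of_forall fun n => ?_) ?_ intervalIntegrable_const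
      (Eventually.of_forall fun r hr => ?_)
    · exact (measurable_comp_gridIdx a b n fun l => g (gridPt a b n (l - 1))).aestronglyMeasurable
    · filter_upwards [eventually_ne_atTop 0] with n hn
      refine Eventually.of_forall fun r hr => hC _ ?_
      rw [uIoc_of_le hab.le] at hr
      exact gridPt_mem_Icc hab.le hn ((Nat.sub_le _ _).trans (gridIdx_le hab hn hr.2))
    · rw [uIoc_of_le hab.le] at hr
      exact (hg.tendsto r).comp (tendsto_gridPt_gridIdx_sub_one hab hr)
  refine hlim.congr' ?_
  filter_upwards [eventually_ne_atTop 0] with n hn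
    using (riemannStieltjesSum_stieltjes hab hn g L).symm

lemma sum_mul_sub_eq (g v : ℕ → ℝ) (n : ℕ) :
    ∑ l ∈ Finset.range n, g l * (v (l + 1) - v l)
      = g n * (v n - v 0) - ∑ l ∈ Finset.range n, (g (l + 1) - g l) * (v (l + 1) - v 0) := by
  induction n with
  | zero => simp
  | succ n ih => rw [Finset.sum_range_succ, Finset.sum_range_succ, ih]; ring

lemma riemannStieltjesSum_by_parts (hab : a < b) (hn : n ≠ 0) {g g' : ℝ → ℝ}
    (hg : ∀ r, HasDerivAt g (g' r) r) (hg' : Continuous g') (w : ℝ → ℝ) :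
    riemannStieltjesSum g w a b n = g b * (w b - w a)
      - ∫ r in a..b, g' r * (w (gridPt a b n (gridIdx a b n r)) - w a) := by
  rw [← sum_integral_gridCell (φ := fun l r => g' r * (w (gridPt a b n l) - w a)) hab hn
      fun _ _ _ => (hg'.mul continuous_const).intervalIntegrable _ _,
    riemannStieltjesSum,
    sum_mul_sub_eq (fun l => g (gridPt a b n l)) fun l => w (gridPt a b n l),
    gridPt_self hn, gridPt_zero]
  congr 1
  refine Finset.sum_congr rfl fun l _ => ?_
  rw [intervalIntegral.integral_mul_const, intervalIntegral.integral_eq_sub_of_hasDerivAt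
    (fun r _ => hg r) (hg'.intervalIntegrable _ _)]

theorem tendsto_riemannStieltjesSum_by_parts (hab : a < b) {g g' : ℝ → ℝ}
    (hg : ∀ r, HasDerivAt g (g' r) r) (hg' : Continuous g') {w : ℝ → ℝ}
    (hw : ∀ r ∈ Icc a b, ContinuousWithinAt w (Icc a b ∩ Ici r) r) {C : ℝ}
    (hC : ∀ r ∈ Icc a b, |w r| ≤ C) :
    Tendsto (riemannStieltjesSum g w a b) atTop
      (𝓝 (g b * (w b - w a) - ∫ r in a..b, g' r * (w r - w a))) := by
  have hlim : Tendsto (fun n => ∫ r in a..b,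
      g' r * (w (gridPt a b n (gridIdx a b n r)) - w a)) atTop
      (𝓝 (∫ r in a..b, g' r * (w r - w a))) := by
    refine intervalIntegral.tendsto_integral_filter_of_dominated_convergence
      (fun r => |g' r| * (C + C)) (Eventually.of_forall fun n => ?_) ?_
      ((hg'.abs.mul continuous_const).intervalIntegrable _ _)
      (Eventually.of_forall fun r hr => ?_)
    · exact (hg'.measurable.mul ((measurable_comp_gridIdx a b n
        fun l => w (gridPt a b n l)).sub_const _)).aestronglyMeasurable
    · filter_upwards [eventually_ne_atTop 0] with n hn
      refine Eventually.of_forall fun r hr => ?_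
      rw [uIoc_of_le hab.le] at hr
      rw [norm_mul, Real.norm_eq_abs, Real.norm_eq_abs]
      refine mul_le_mul_of_nonneg_left ((abs_sub _ _).trans (add_le_add (hC _ ?_) (hC a ?_)))
        (abs_nonneg _)
      · exact gridPt_mem_Icc hab.le hn (gridIdx_le hab hn hr.2)
      · exact left_mem_Icc.2 hab.le
    · rw [uIoc_of_le hab.le] at hr
      have hr' := Ioc_subset_Icc_self hr
      exact (((hw r hr').tendsto.comp (tendsto_gridPt_gridIdx hab hr')).sub_const _).const_mul _
  refine (tendsto_const_nhds.sub hlim).congr' ?_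
  filter_upwards [eventually_ne_atTop 0] with n hn
    using (riemannStieltjesSum_by_parts hab hn hg hg' w).symm

lemma aestronglyMeasurable_of_rightCont {F : Type*} [TopologicalSpace F]
    [TopologicalSpace.PseudoMetrizableSpace F] [SecondCountableTopology F] {w : ℝ → F}
    (hw : ∀ r ∈ Icc a b, ContinuousWithinAt w (Icc a b ∩ Ici r) r) :
    AEStronglyMeasurable w (volume.restrict (Ioc a b)) := by
  borelize F
  rcases lt_or_ge a b with hab | hab
  · refine aestronglyMeasurable_of_tendsto_ae atTop
      (f := fun (n : ℕ) r => w (gridPt a b n (gridIdx a b n r)))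
      (fun n => (measurable_comp_gridIdx a b n
        fun l => w (gridPt a b n l)).aestronglyMeasurable) ?_
    filter_upwards [ae_restrict_mem measurableSet_Ioc] with r hr
    have hr' := Ioc_subset_Icc_self hr
    exact (hw r hr').tendsto.comp (tendsto_gridPt_gridIdx hab hr')
  · simp [Ioc_eq_empty_of_le hab]

lemma intervalIntegrable_of_rightCont {F : Type*} [NormedAddCommGroup F]
    [SecondCountableTopology F] (hab : a ≤ b) {w : ℝ → F}
    (hw : ∀ r ∈ Icc a b, ContinuousWithinAt w (Icc a b ∩ Ici r) r) {C : ℝ}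
    (hC : ∀ r ∈ Icc a b, ‖w r‖ ≤ C) : IntervalIntegrable w volume a b := by
  rw [intervalIntegrable_iff_integrableOn_Ioc_of_le hab]
  refine Integrable.of_bound (aestronglyMeasurable_of_rightCont hw) C ?_
  filter_upwards [ae_restrict_mem measurableSet_Ioc] with r hr
  exact hC r (Ioc_subset_Icc_self hr)

end RiemannStieltjes

section LinearEquation

variable {a b : ℝ}

lemma hasDerivWithinAt_integral_of_rightCont {g : ℝ → ℝ}
    (hg : ∀ r ∈ Icc a b, ContinuousWithinAt g (Icc a b ∩ Ici r) r)
    (hgi : IntervalIntegrable g volume a b) {r : ℝ} (hr : r ∈ Ioo a b) :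
    HasDerivWithinAt (fun r => ∫ u in a..r, g u) (g r) (Ioi r) r := by
  have hab := (hr.1.trans hr.2).le
  have hgr : IntervalIntegrable g volume a r :=
    hgi.mono_set (uIcc_subset_uIcc_left (by simpa [uIcc_of_le hab] using Ioo_subset_Icc_self hr))
  refine HasDerivWithinAt.mono ?_ Ioi_subset_Ici_self
  refine intervalIntegral.integral_hasDerivWithinAt_right hgr (t := Ioi r)
    ⟨Ioc a b, mem_nhdsWithin_of_mem_nhds (mem_of_superset (Ioo_mem_nhds hr.1 hr.2)
      Ioo_subset_Ioc_self), aestronglyMeasurable_of_rightCont hg⟩ ?_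
  refine (hg r (Ioo_subset_Icc_self hr)).mono_of_mem_nhdsWithin (inter_mem ?_ ?_)
  · exact mem_nhdsWithin_of_mem_nhds (Icc_mem_nhds hr.1 hr.2)
  · exact mem_of_superset self_mem_nhdsWithin Ioi_subset_Ici_self

lemma hasDerivAt_exp_mul_sub (α b r : ℝ) :
    HasDerivAt (fun r => Real.exp (α * (b - r))) (-(α * Real.exp (α * (b - r)))) r := by
  simpa [mul_comm] using (((hasDerivAt_id' r).const_sub b).const_mul α).exp

/-- Duhamel's formula for `dz = (α z + f) dr + dw`, with the integral against `dw` integrated by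
parts, as `w` need not have bounded variation. -/
theorem linearEquation_increment {α : ℝ} {z f w : ℝ → ℝ} (hab : a ≤ b)
    (hz : ∀ r ∈ Icc a b, ContinuousWithinAt z (Icc a b ∩ Ici r) r)
    (hzi : IntervalIntegrable z volume a b) (hf : ContinuousOn f (Icc a b))
    (heq : ∀ r ∈ Icc a b, z r = z a + (∫ u in a..r, (α * z u + f u)) + (w r - w a)) :
    z b - Real.exp (α * (b - a)) * z a - (∫ r in a..b, Real.exp (α * (b - r)) * f r)
      = w b - w a + ∫ r in a..b, α * Real.exp (α * (b - r)) * (w r - w a) := by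
  have hexp : Continuous fun r => Real.exp (α * (b - r)) := by fun_prop
  have hfi : IntervalIntegrable f volume a b := (hf.mono (uIcc_of_le hab).subset).intervalIntegrable
  have hgi : IntervalIntegrable (fun u => α * z u + f u) volume a b := (hzi.const_mul α).add hfi
  set v : ℝ → ℝ := fun r => z a + ∫ u in a..r, (α * z u + f u) with hv
  have hwv : ∀ r ∈ Icc a b, w r - w a = z r - v r := fun r hr => by rw [heq r hr, hv]; ring
  have hvc : ContinuousOn v (Icc a b) := by
    rw [← uIcc_of_le hab]
    exact continuousOn_const.add (intervalIntegral.continuousOn_primitive_interval' hgi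
      left_mem_uIcc)
  have hderiv : ∀ r ∈ Ioo a b, HasDerivWithinAt (fun r => Real.exp (α * (b - r)) * v r)
      (Real.exp (α * (b - r)) * f r + α * Real.exp (α * (b - r)) * (w r - w a)) (Ioi r) r := by
    intro r hr
    refine ((hasDerivAt_exp_mul_sub α b r).hasDerivWithinAt.mul
      ((hasDerivWithinAt_integral_of_rightCont (fun u hu => ?_) hgi hr).const_add
        (z a))).congr_deriv ?_
    · exact ((hz u hu).const_mul α).add ((hf u hu).mono inter_subset_left)
    · simp only [hwv r (Ioo_subset_Icc_self hr), hv]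
      ring
  have hwi : IntervalIntegrable (fun r => w r - w a) volume a b := by
    refine (hzi.sub (hvc.mono (uIcc_of_le hab).subset).intervalIntegrable).congr fun r hr => ?_
    rw [uIoc_of_le hab] at hr
    exact (hwv r (Ioc_subset_Icc_self hr)).symm
  have hEf : IntervalIntegrable (fun r => Real.exp (α * (b - r)) * f r) volume a b :=
    hfi.continuousOn_mul hexp.continuousOn
  have hEw : IntervalIntegrable (fun r => α * Real.exp (α * (b - r)) * (w r - w a)) volume a b :=
    hwi.continuousOn_mul (hexp.const_mul α).continuousOn
  have hftc := intervalIntegral.integral_eq_sub_of_hasDeriv_right_of_le hab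
    (hexp.continuousOn.mul hvc) hderiv (hEf.add hEw)
  rw [intervalIntegral.integral_add hEf hEw] at hftc
  have hva : v a = z a := by simp only [hv, intervalIntegral.integral_same, add_zero]
  have hvb := hwv b (right_mem_Icc.2 hab)
  simp only [Pi.mul_apply, hva, sub_self, mul_zero, Real.exp_zero, one_mul] at hftc
  linarith

end LinearEquation

lemma IsCadlagOn.exists_bound {F : Type*} [NormedAddCommGroup F] {g : ℝ → F} {a b : ℝ}
    (hg : IsCadlagOn g (Icc a b)) : ∃ C, ∀ r ∈ Icc a b, ‖g r‖ ≤ C := by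
  refine isCompact_Icc.induction_on (p := fun s => ∃ C, ∀ r ∈ s, ‖g r‖ ≤ C) ⟨0, by simp⟩
    (fun s t hst ⟨C, hC⟩ => ⟨C, fun r hr => hC r (hst hr)⟩)
    (fun s t ⟨C, hC⟩ ⟨D, hD⟩ => ⟨max C D, fun r hr => hr.elim
      (fun h => (hC r h).trans (le_max_left _ _)) (fun h => (hD r h).trans (le_max_right _ _))⟩)
    fun r hr => ?_
  obtain ⟨hright, l, hl⟩ := hg r hr
  have hbdd_right : ∀ᶠ u in 𝓝[Icc a b ∩ Ici r] r, ‖g u‖ < ‖g r‖ + 1 :=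
    hright.norm.eventually (gt_mem_nhds (lt_add_one _))
  have hbdd_left : ∀ᶠ u in 𝓝[Icc a b ∩ Iio r] r, ‖g u‖ < ‖l‖ + 1 :=
    hl.norm.eventually (gt_mem_nhds (lt_add_one _))
  refine ⟨{u | ‖g u‖ ≤ max (‖g r‖ + 1) (‖l‖ + 1)}, ?_, _, fun u hu => hu⟩
  rw [← inter_univ (Icc a b), ← Ici_union_Iio (a := r), inter_union_distrib_left, nhdsWithin_union]
  exact ⟨hbdd_right.mono fun u hu => hu.le.trans (le_max_left _ _),
    hbdd_left.mono fun u hu => hu.le.trans (le_max_right _ _)⟩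

lemma IsCadlagOn.mono_Icc {F : Type*} [TopologicalSpace F] {g : ℝ → F} {a b a' b' : ℝ}
    (hg : IsCadlagOn g (Icc a b)) (ha : a ≤ a') (hb : b' ≤ b) : IsCadlagOn g (Icc a' b') := by
  have hsub := Icc_subset_Icc ha hb
  intro r hr
  obtain ⟨hright, l, hl⟩ := hg r (hsub hr)
  exact ⟨hright.mono (inter_subset_inter_left _ hsub), l,
    hl.mono_left (nhdsWithin_mono _ (inter_subset_inter_left _ hsub))⟩

lemma IsCadlagOn.continuous_comp {F G : Type*} [TopologicalSpace F] [TopologicalSpace G]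
    {g : ℝ → F} {S : Set ℝ} (hg : IsCadlagOn g S) {φ : F → G} (hφ : Continuous φ) :
    IsCadlagOn (fun r => φ (g r)) S := by
  intro r hr
  obtain ⟨hright, l, hl⟩ := hg r hr
  exact ⟨hφ.continuousAt.comp_continuousWithinAt hright, φ l, (hφ.tendsto l).comp hl⟩

lemma IsCadlagOn.intervalIntegrable {F : Type*} [NormedAddCommGroup F]
    [SecondCountableTopology F] {g : ℝ → F} {a b : ℝ} (hab : a ≤ b)
    (hg : IsCadlagOn g (Icc a b)) : IntervalIntegrable g volume a b := by
  obtain ⟨C, hC⟩ := hg.exists_bound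
  exact intervalIntegrable_of_rightCont hab (fun r hr => (hg r hr).1) hC

section Matrices

variable {N : ℕ}

lemma act_eq_toEuclideanCLM (M : Matrix (Fin N) (Fin N) ℝ) :
    act M = Matrix.toEuclideanCLM (𝕜 := ℝ) M := rfl

lemma continuous_act (M : Matrix (Fin N) (Fin N) ℝ) : Continuous (act M) :=
  (Matrix.toEuclideanCLM (𝕜 := ℝ) M).continuous

lemma act_add (M : Matrix (Fin N) (Fin N) ℝ) (x y : EuclideanSpace ℝ (Fin N)) :
    act M (x + y) = act M x + act M y := map_add (Matrix.toEuclideanCLM (𝕜 := ℝ) M) x y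

lemma act_sum {ι : Type*} (M : Matrix (Fin N) (Fin N) ℝ) (s : Finset ι)
    (g : ι → EuclideanSpace ℝ (Fin N)) : act M (∑ k ∈ s, g k) = ∑ k ∈ s, act M (g k) :=
  map_sum (Matrix.toEuclideanCLM (𝕜 := ℝ) M) g s

lemma act_one (x : EuclideanSpace ℝ (Fin N)) : act 1 x = x := by simp [act]

lemma act_mul (M M' : Matrix (Fin N) (Fin N) ℝ) (x : EuclideanSpace ℝ (Fin N)) :
    act (M * M') x = act M (act M' x) := by simp [act, Matrix.mulVec_mulVec]

lemma act_diagonal_apply (d : Fin N → ℝ) (x : EuclideanSpace ℝ (Fin N)) (p : Fin N) :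
    act (Matrix.diagonal d) x p = d p * x p := by
  simp [act, Matrix.mulVec_diagonal]

lemma expMat_zero (A : Matrix (Fin N) (Fin N) ℝ) : expMat A 0 = 1 := by
  rw [expMat, zero_smul, NormedSpace.exp_zero]

lemma expMat_add (A : Matrix (Fin N) (Fin N) ℝ) (r u : ℝ) :
    expMat A (r + u) = expMat A r * expMat A u := by
  rw [expMat, add_smul, Matrix.exp_add_of_commute]
  · rfl
  · exact ((Commute.refl A).smul_left r).smul_right u

lemma expMat_diagonal (α : Fin N → ℝ) (r : ℝ) :
    expMat (Matrix.diagonal α) r = Matrix.diagonal fun p => Real.exp (α p * r) := by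
  rw [expMat, ← Matrix.diagonal_smul, Matrix.exp_diagonal]
  congr 1
  ext p
  rw [Pi.coe_exp, Real.exp_eq_exp_ℝ, Pi.smul_apply, smul_eq_mul, mul_comm]

lemma sqrtMat_diagonal {d : Fin N → ℝ} (hd : ∀ p, 0 ≤ d p) :
    sqrtMat (Matrix.diagonal d) = Matrix.diagonal fun p => √(d p) := by
  refine CFC.sqrt_unique ?_ ?_
  · simp only [Matrix.diagonal_mul_diagonal, Real.mul_self_sqrt (hd _)]
  · rw [Matrix.nonneg_iff_posSemidef]
    exact Matrix.PosSemidef.diagonal fun p => Real.sqrt_nonneg _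

lemma invSqrtMat_diagonal {d : Fin N → ℝ} (hd : ∀ p, 0 < d p) :
    invSqrtMat (Matrix.diagonal d) = Matrix.diagonal fun p => (√(d p))⁻¹ := by
  rw [invSqrtMat, sqrtMat_diagonal fun p => (hd p).le]
  refine Matrix.inv_eq_left_inv ?_
  simp only [Matrix.diagonal_mul_diagonal, inv_mul_cancel₀ (Real.sqrt_pos.2 (hd _)).ne',
    Matrix.diagonal_one]

lemma act_sqrtMat_act_invSqrtMat {M : Matrix (Fin N) (Fin N) ℝ} (hM : M.PosDef)
    (x : EuclideanSpace ℝ (Fin N)) : act (sqrtMat M) (act (invSqrtMat M) x) = x := by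
  have hunit : IsUnit (sqrtMat M) :=
    (CFC.isUnit_sqrt_iff M (Matrix.nonneg_iff_posSemidef.2 hM.posSemidef)).2 hM.isUnit
  rw [← act_mul, invSqrtMat, Matrix.mul_nonsing_inv _ ((Matrix.isUnit_iff_isUnit_det _).1 hunit),
    act_one]

lemma TimeChange.nonneg (ℓ : TimeChange) (r : ℝ≥0) : 0 ≤ ℓ.toFun r := by
  rw [← ℓ.map_zero]
  exact ℓ.strictMono.monotone zero_le

lemma TimeChange.setIntegral_pos (ℓ : TimeChange) {a b : ℝ} (ha : 0 ≤ a) (hab : a < b) {g : ℝ → ℝ}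
    (hg : Continuous g) (hpos : ∀ r, 0 < g r) : 0 < ∫ r in Ioc a b, g r ∂ℓ.stieltjes.measure := by
  have hint : IntegrableOn g (Ioc a b) ℓ.stieltjes.measure :=
    (intervalIntegrable_iff_integrableOn_Ioc_of_le hab.le).1 (hg.intervalIntegrable _ _)
  rw [setIntegral_pos_iff_support_of_nonneg_ae (Eventually.of_forall fun r => (hpos r).le) hint,
    Function.support_eq_univ fun r => (hpos r).ne', univ_inter, ℓ.stieltjes.measure_Ioc,
    ENNReal.ofReal_pos, sub_pos]
  exact ℓ.strictMono ((Real.toNNReal_lt_toNNReal_iff (ha.trans_lt hab)).2 hab)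

/-- The diagonal of `covMat`, for the diagonal matrices with diagonals `α` and `q`. -/
def covDiag (α q : Fin N → ℝ) (ℓ : TimeChange) (a b : ℝ) (p : Fin N) : ℝ :=
  ∫ r in Ioc a b, q p * Real.exp (α p * (b - r)) ^ 2 ∂ℓ.stieltjes.measure

lemma covMat_diagonal (α q : Fin N → ℝ) (ℓ : TimeChange) (a b : ℝ) :
    covMat (Matrix.diagonal α) (Matrix.diagonal q) ℓ a b
      = Matrix.diagonal (covDiag α q ℓ a b) := by
  ext p p'
  simp only [covMat, Matrix.of_apply, expMat_diagonal, Matrix.diagonal_mul_diagonal]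
  rcases eq_or_ne p p' with rfl | hne
  · simp only [Matrix.diagonal_apply_eq, covDiag]
    congr 1 with r
    rw [← Real.exp_nat_mul, mul_comm, Nat.cast_two, mul_left_comm]
  · simp only [Matrix.diagonal_apply_ne _ hne, integral_zero]

lemma covDiag_pos (α : Fin N → ℝ) {q : Fin N → ℝ} (hq : ∀ p, 0 < q p) (ℓ : TimeChange) {a b : ℝ}
    (ha : 0 ≤ a) (hab : a < b) (p : Fin N) : 0 < covDiag α q ℓ a b p :=
  ℓ.setIntegral_pos ha hab (by fun_prop) fun r => mul_pos (hq p) (pow_pos (Real.exp_pos _) 2)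

lemma posDef_covMat_diagonal (α : Fin N → ℝ) {q : Fin N → ℝ} (hq : ∀ p, 0 < q p) (ℓ : TimeChange)
    {a b : ℝ} (ha : 0 ≤ a) (hab : a < b) :
    (covMat (Matrix.diagonal α) (Matrix.diagonal q) ℓ a b).PosDef := by
  rw [covMat_diagonal]
  exact Matrix.PosDef.diagonal (covDiag_pos α hq ℓ ha hab)

lemma driftInt_diagonal_apply (α : Fin N → ℝ) {f : ℝ → EuclideanSpace ℝ (Fin N)} {a b : ℝ}
    (hab : a ≤ b) (hf : ContinuousOn f (Icc a b)) (p : Fin N) :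
    driftInt (Matrix.diagonal α) f a b p = ∫ r in a..b, Real.exp (α p * (b - r)) * f r p := by
  have hcont : ContinuousOn (fun r => act (expMat (Matrix.diagonal α) (b - r)) (f r))
      (uIcc a b) := by
    rw [uIcc_of_le hab]
    have : ContinuousOn (fun r => WithLp.toLp 2 fun p => Real.exp (α p * (b - r)) * f r p)
        (Icc a b) := by fun_prop
    refine this.congr fun r _ => ?_
    ext p
    rw [expMat_diagonal, act_diagonal_apply]
  have hproj := (EuclideanSpace.proj (𝕜 := ℝ) p).intervalIntegral_comp_comm
    (hcont.intervalIntegrable (μ := volume))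
  refine hproj.symm.trans ?_
  simp only [expMat_diagonal, PiLp.proj_apply, act_diagonal_apply]

/-- `g ↦ e^{(b-a)A} y + F_{a,b} + (I^ℓ_{a,b})^{1/2} g`, the value at time `b` of the process with
time change `ℓ` started from `y` at time `a`, as a function of its normalised increment. -/
def transition (A Q : Matrix (Fin N) (Fin N) ℝ) (f : ℝ → EuclideanSpace ℝ (Fin N))
    (ℓ : TimeChange) (a b : ℝ) (y g : EuclideanSpace ℝ (Fin N)) : EuclideanSpace ℝ (Fin N) :=
  act (expMat A (b - a)) y + driftInt A f a b + act (sqrtMat (covMat A Q ℓ a b)) g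

lemma measurable_transition (A Q : Matrix (Fin N) (Fin N) ℝ) (f : ℝ → EuclideanSpace ℝ (Fin N))
    (ℓ : TimeChange) (a b : ℝ) : Measurable (transition A Q f ℓ a b).uncurry := by
  refine Continuous.measurable (Continuous.add (Continuous.add ?_ continuous_const) ?_)
  · exact (continuous_act _).comp continuous_fst
  · exact (continuous_act _).comp continuous_snd

lemma transition_normIncr {A Q : Matrix (Fin N) (Fin N) ℝ} {ℓ : TimeChange} {a b : ℝ}
    (hcov : (covMat A Q ℓ a b).PosDef) (f ζ : ℝ → EuclideanSpace ℝ (Fin N)) :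
    transition A Q f ℓ a b (ζ a) (normIncr A Q f ℓ ζ a b) = ζ b := by
  rw [transition, normIncr, act_sqrtMat_act_invSqrtMat hcov]
  abel

variable (A Q : Matrix (Fin N) (Fin N) ℝ) (f : ℝ → EuclideanSpace ℝ (Fin N)) (ℓ : ℕ → TimeChange)
  (τ : ℕ → ℝ) (ζ : ℝ → EuclideanSpace ℝ (Fin N))

lemma rescaledState_self (m : ℕ) : rescaledState A Q f ℓ τ m ζ m = ζ (τ m) := by
  rw [rescaledState, Finset.Icc_eq_empty (by lia), Finset.sum_empty, zero_add, sub_self,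
    expMat_zero, act_one]

lemma rescaledState_eq_transition {m j : ℕ} (hj : j < m) :
    rescaledState A Q f ℓ τ m ζ j
      = transition A Q f (ℓ j) (τ (j + 1)) (τ j) (rescaledState A Q f ℓ τ m ζ (j + 1))
          (normIncr A Q f (ℓ m) ζ (τ (j + 1)) (τ j)) := by
  rw [transition, rescaledState, rescaledState,
    ← Finset.insert_Icc_add_one_left_eq_Icc (by lia : j + 1 ≤ m),
    Finset.sum_insert (by simp), act_add _ (∑ k ∈ _, _), act_sum]
  simp only [← act_mul, ← expMat_add, add_tsub_cancel_right, sub_self, expMat_zero, act_one,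
    sub_add_sub_cancel]
  abel

end Matrices

section Gaussian

variable {E : Type*} [NormedAddCommGroup E] [InnerProductSpace ℝ E]

/-- The density of the standard Gaussian measure with respect to the Lebesgue measure. -/
def stdGaussianDensity (z : E) : ℝ :=
  ((2 * Real.pi) ^ ((Module.finrank ℝ E : ℝ) / 2))⁻¹ * Real.exp (-(1 / 2) * ‖z‖ ^ 2)

lemma stdGaussianDensity_pos (z : E) : 0 < stdGaussianDensity z := by
  unfold stdGaussianDensity; positivity

lemma continuous_stdGaussianDensity : Continuous (stdGaussianDensity (E := E)) := by
  unfold stdGaussianDensity; fun_prop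

lemma hasFDerivAt_stdGaussianDensity (z : E) :
    HasFDerivAt stdGaussianDensity (-(stdGaussianDensity z • innerSL ℝ z)) z := by
  refine ((((hasFDerivAt_id z).norm_sq.const_mul (-(1 / 2))).exp).const_mul
    ((2 * Real.pi) ^ ((Module.finrank ℝ E : ℝ) / 2))⁻¹).congr_fderiv ?_
  ext w
  simp only [id_eq, ContinuousLinearMap.comp_id, neg_apply, smul_apply, innerSL_apply_apply,
    nsmul_eq_mul, smul_eq_mul, stdGaussianDensity]
  ring

lemma stdGaussianDensity_mul_norm_le {z z' : E} (hz : ‖z - z'‖ ≤ 1) :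
    stdGaussianDensity z * ‖z‖
      ≤ ((2 * Real.pi) ^ ((Module.finrank ℝ E : ℝ) / 2))⁻¹ * Real.exp (1 / 4)
        * Real.exp (-(1 / 8) * ‖z'‖ ^ 2) := by
  have hlin : ‖z‖ ≤ Real.exp (1 / 4 * ‖z‖ ^ 2) := by
    have := Real.add_one_le_exp (1 / 4 * ‖z‖ ^ 2)
    nlinarith [sq_nonneg (‖z‖ / 2 - 1)]
  have hshift : ‖z'‖ ^ 2 ≤ 2 * ‖z‖ ^ 2 + 2 := by
    have htri : ‖z'‖ ≤ ‖z‖ + 1 := by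
      rw [norm_sub_rev] at hz
      linarith [norm_le_insert' z' z]
    nlinarith [norm_nonneg z', sq_nonneg (‖z‖ - 1)]
  rw [stdGaussianDensity, mul_assoc, mul_assoc]
  refine mul_le_mul_of_nonneg_left ?_ (by positivity)
  calc Real.exp (-(1 / 2) * ‖z‖ ^ 2) * ‖z‖
      ≤ Real.exp (-(1 / 2) * ‖z‖ ^ 2) * Real.exp (1 / 4 * ‖z‖ ^ 2) := by gcongr
    _ = Real.exp (-(1 / 4) * ‖z‖ ^ 2) := by rw [← Real.exp_add]; congr 1; ring
    _ ≤ Real.exp (1 / 4 + -(1 / 8) * ‖z'‖ ^ 2) := Real.exp_le_exp.2 (by linarith)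
    _ = Real.exp (1 / 4) * Real.exp (-(1 / 8) * ‖z'‖ ^ 2) := Real.exp_add _ _

variable [FiniteDimensional ℝ E] [MeasurableSpace E] [BorelSpace E]

lemma integrable_exp_neg_mul_sq_norm {c : ℝ} (hc : 0 < c) :
    Integrable fun z : E => Real.exp (-c * ‖z‖ ^ 2) := by
  refine (GaussianFourier.integrable_cexp_neg_mul_sq_norm_add (V := E) (b := (c : ℂ))
    (by simpa using hc) 0 0).norm.congr (Eventually.of_forall fun z => ?_)
  simp only [zero_mul, add_zero, Complex.norm_exp]
  norm_cast

lemma integrable_stdGaussianDensity : Integrable (stdGaussianDensity (E := E)) :=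
  (integrable_exp_neg_mul_sq_norm (by norm_num)).const_mul _

lemma integral_withDensity_stdGaussianDensity {F : Type*} [NormedAddCommGroup F]
    [NormedSpace ℝ F] (h : E → F) :
    ∫ z, h z ∂(volume.withDensity fun z : E => ENNReal.ofReal (stdGaussianDensity z))
      = ∫ z, stdGaussianDensity z • h z := by
  rw [integral_withDensity_eq_integral_toReal_smul
    continuous_stdGaussianDensity.measurable.ennreal_ofReal
    (Eventually.of_forall fun _ => ENNReal.ofReal_lt_top)]
  simp only [ENNReal.toReal_ofReal (stdGaussianDensity_pos _).le]

theorem stdGaussian_eq_withDensity :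
    stdGaussian E = volume.withDensity fun z => ENNReal.ofReal (stdGaussianDensity z) := by
  have := isFiniteMeasure_withDensity_ofReal (integrable_stdGaussianDensity (E := E)).2
  refine Measure.ext_of_charFun (funext fun t => ?_)
  rw [charFun_stdGaussian, charFun_apply, integral_withDensity_stdGaussianDensity]
  have hfourier := GaussianFourier.integral_cexp_neg_mul_sq_norm_add (V := E) (b := (1 / 2 : ℂ))
    (by norm_num) Complex.I t
  have hconst : ((((2 * Real.pi) ^ ((Module.finrank ℝ E : ℝ) / 2))⁻¹ : ℝ) : ℂ)
      * ((Real.pi : ℂ) / (1 / 2)) ^ ((Module.finrank ℝ E : ℂ) / 2) = 1 := by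
    have hcpow : ((Real.pi : ℂ) / (1 / 2)) ^ ((Module.finrank ℝ E : ℂ) / 2)
        = (((2 * Real.pi) ^ ((Module.finrank ℝ E : ℝ) / 2) : ℝ) : ℂ) := by
      rw [Complex.ofReal_cpow (by positivity)]
      congr 1 <;> push_cast <;> ring
    rw [hcpow, ← Complex.ofReal_mul, inv_mul_cancel₀ (by positivity), Complex.ofReal_one]
  have hintegrand : ∀ z : E, stdGaussianDensity z • Complex.exp ((⟪z, t⟫ : ℝ) * Complex.I)
      = ((((2 * Real.pi) ^ ((Module.finrank ℝ E : ℝ) / 2))⁻¹ : ℝ) : ℂ)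
        * Complex.exp (-(1 / 2) * (‖z‖ : ℂ) ^ 2 + Complex.I * (⟪t, z⟫ : ℝ)) := fun z => by
    rw [stdGaussianDensity, Complex.exp_add, real_inner_comm, mul_comm Complex.I,
      Complex.real_smul]
    push_cast
    ring
  simp only [hintegrand]
  rw [integral_const_mul, hfourier, ← mul_assoc, hconst, one_mul, Complex.I_sq]
  congr 1
  ring

lemma integral_add_stdGaussian {F : Type*} [NormedAddCommGroup F] [NormedSpace ℝ F]
    (φ : E → E → F) (v : E) :
    ∫ g, φ (v + g) g ∂(stdGaussian E) = ∫ z, stdGaussianDensity (z - v) • φ z (z - v) := by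
  rw [stdGaussian_eq_withDensity, integral_withDensity_stdGaussianDensity,
    ← integral_add_left_eq_self (fun z => stdGaussianDensity (z - v) • φ z (z - v)) v]
  simp only [add_sub_cancel_left]

theorem hasFDerivAt_integral_add_stdGaussian {h : E → ℝ} (hm : Measurable h) {C : ℝ}
    (hC : ∀ z, |h z| ≤ C) (v : E) :
    HasFDerivAt (fun v => ∫ g, h (v + g) ∂(stdGaussian E))
      (∫ g, h (v + g) • innerSL ℝ g ∂(stdGaussian E)) v := by
  rw [integral_add_stdGaussian (fun z g => h z • innerSL ℝ g)]
  simp only [fun v => integral_add_stdGaussian (fun z _ => h z) v]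
  refine hasFDerivAt_integral_of_dominated_of_fderiv_le
    (F := fun v z => stdGaussianDensity (z - v) • h z)
    (F' := fun v z => stdGaussianDensity (z - v) • h z • innerSL ℝ (z - v))
    (bound := fun z => C * (((2 * Real.pi) ^ ((Module.finrank ℝ E : ℝ) / 2))⁻¹ * Real.exp (1 / 4)
        * Real.exp (-(1 / 8) * ‖z - v‖ ^ 2)))
    (Metric.ball_mem_nhds v one_pos) (Eventually.of_forall fun u => ?_) ?_ ?_
    (Eventually.of_forall fun z u hu => ?_) ?_ (Eventually.of_forall fun z u _ => ?_)
  · exact ((continuous_stdGaussianDensity.comp (continuous_id.sub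
      continuous_const)).measurable.mul hm).aestronglyMeasurable
  · exact (integrable_stdGaussianDensity.comp_sub_right v).mul_bdd hm.aestronglyMeasurable
      (Eventually.of_forall hC)
  · exact (continuous_stdGaussianDensity.comp (continuous_id.sub
      continuous_const)).aestronglyMeasurable.smul (hm.aestronglyMeasurable.smul
      ((innerSL ℝ).continuous.comp (continuous_id.sub continuous_const)).aestronglyMeasurable)
  · have hzu : ‖z - u - (z - v)‖ ≤ 1 := by
      rw [sub_sub_sub_cancel_left, ← dist_eq_norm, dist_comm]
      exact (Metric.mem_ball.1 hu).le
    rw [smul_comm, norm_smul, norm_smul, innerSL_apply_norm, Real.norm_of_nonneg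
      (stdGaussianDensity_pos _).le]
    exact mul_le_mul (hC z) (stdGaussianDensity_mul_norm_le hzu)
      (mul_nonneg (stdGaussianDensity_pos _).le (norm_nonneg _)) ((abs_nonneg _).trans (hC z))
  · exact (((integrable_exp_neg_mul_sq_norm (by norm_num)).comp_sub_right v).const_mul
      _).const_mul _
  · refine (((hasFDerivAt_stdGaussianDensity (z - u)).comp u
      ((hasFDerivAt_id u).const_sub z)).mul_const (h z)).congr_fderiv ?_
    ext w
    simp only [ContinuousLinearMap.comp_neg, ContinuousLinearMap.comp_id, neg_neg, smul_apply,
      innerSL_apply_apply, smul_eq_mul]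
    ring

lemma integrable_norm_stdGaussian : Integrable (fun g : E => ‖g‖) (stdGaussian E) :=
  ((IsGaussian.memLp_id (stdGaussian E) 1 (by simp)).integrable le_rfl).norm

/-- A Bismut-type formula: as `S` is onto, the derivative falls on the Gaussian weight. -/
theorem hasFDerivAt_integral_affine_stdGaussian {h : E → ℝ} (hm : Measurable h) {C : ℝ}
    (hC : ∀ z, |h z| ≤ C) {S R : E →L[ℝ] E} (hSR : ∀ x, S (R x) = x) (D : E →L[ℝ] E) (c y : E) :
    HasFDerivAt (fun y => ∫ g, h (D y + c + S g) ∂(stdGaussian E))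
      ((∫ g, h (D y + c + S g) • innerSL ℝ g ∂(stdGaussian E)) ∘L R ∘L D) y := by
  have harg : ∀ y g, c + S (R (D y) + g) = D y + c + S g := fun y g => by
    rw [map_add, hSR]; abel
  have hcomp := (hasFDerivAt_integral_add_stdGaussian (h := fun z => h (c + S z))
    (hm.comp (by fun_prop)) (fun z => hC _) (R (D y))).comp y (R ∘L D).hasFDerivAt
  simpa only [Function.comp_def, ContinuousLinearMap.comp_apply, harg] using hcomp

lemma integral_smul_innerSL_apply {h : E → ℝ} (hm : Measurable h) {C : ℝ} (hC : ∀ z, |h z| ≤ C)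
    (v : E) :
    (∫ g, h g • innerSL ℝ g ∂(stdGaussian E)) v = ∫ g, h g * ⟪v, g⟫ ∂(stdGaussian E) := by
  have hint : Integrable (fun g : E => innerSL ℝ g) (stdGaussian E) :=
    (innerSL ℝ (E := E)).integrable_comp
      ((IsGaussian.memLp_id (stdGaussian E) 1 (by simp)).integrable le_rfl)
  have hint' : Integrable (fun g : E => h g • innerSL ℝ g) (stdGaussian E) :=
    hint.bdd_smul C hm.aestronglyMeasurable (Eventually.of_forall hC)
  rw [ContinuousLinearMap.integral_apply hint']
  simp only [smul_apply, innerSL_apply_apply, smul_eq_mul, real_inner_comm]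

theorem map_eq_pi_stdGaussian {Ω ι : Type*} [MeasurableSpace Ω] [Fintype ι] {P : Measure Ω}
    [IsFiniteMeasure P] {G : ι → Ω → E} (hG : ∀ j, Measurable (G j))
    (hchar : ∀ c : ι → E, ∫ ω, Complex.exp (((∑ j, ⟪G j ω, c j⟫ : ℝ) : ℂ) * Complex.I) ∂P
      = Complex.exp ((-(∑ j, ‖c j‖ ^ 2) / 2 : ℝ))) :
    P.map (fun ω j => G j ω) = Measure.pi fun _ => stdGaussian E := by
  have hGm : Measurable fun ω j => G j ω := measurable_pi_lambda _ hG
  rw [← charFun_eq_pi_iff]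
  intro t
  rw [charFun_apply, Measure.map_map (by fun_prop) hGm,
    integral_map (by fun_prop) (by fun_prop)]
  simp only [charFun_stdGaussian, ← Complex.exp_sum]
  refine (hchar t).trans ?_
  push_cast
  rw [← Finset.sum_neg_distrib, Finset.sum_div]

end Gaussian

section Refinement

/-- The common refinement of the intervals `[θ j, θ (j + 1)]`, with `n` cells for each of them. -/
def refGrid (θ : ℕ → ℝ) (n k : ℕ) : ℝ := gridPt (θ (k / n)) (θ (k / n + 1)) n (k % n)

variable (θ : ℕ → ℝ) {n l : ℕ}

lemma refGrid_eq (j : ℕ) (hl : l < n) :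
    refGrid θ n (l + n * j) = gridPt (θ j) (θ (j + 1)) n l := by
  rw [refGrid, Nat.add_mul_div_left _ _ (by lia), Nat.div_eq_of_lt hl, zero_add,
    Nat.add_mul_mod_self_left, Nat.mod_eq_of_lt hl]

lemma refGrid_succ_eq (j : ℕ) (hl : l < n) :
    refGrid θ n (l + n * j + 1) = gridPt (θ j) (θ (j + 1)) n (l + 1) := by
  rcases (Nat.succ_le_of_lt hl).lt_or_eq with h | rfl
  · rw [add_right_comm, refGrid_eq θ j h]
  · rw [(by lia : l + (l + 1) * j + 1 = 0 + (l + 1) * (j + 1)), refGrid_eq θ (j + 1) (by lia),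
      gridPt_zero, gridPt_self (by lia)]

variable {θ}

lemma refGrid_mono (hθ : Monotone θ) (hn : n ≠ 0) : Monotone (refGrid θ n) := by
  refine monotone_nat_of_le_succ fun k => ?_
  have hl : k % n < n := Nat.mod_lt _ (Nat.pos_of_ne_zero hn)
  rw [← Nat.mod_add_div k n, refGrid_eq θ _ hl, refGrid_succ_eq θ _ hl]
  exact gridPt_mono (hθ (Nat.le_succ _)) n (Nat.le_succ _)

end Refinement

section TimeChanged

variable {N : ℕ} {Ω : Type*} {W : ℝ≥0 → Ω → EuclideanSpace ℝ (Fin N)}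

/-- The component number `p` of `r ↦ W_{ℓ_r}`, which is constant on the negative half-line. -/
def timeChanged (W : ℝ≥0 → Ω → EuclideanSpace ℝ (Fin N)) (ℓ : TimeChange) (ω : Ω) (p : Fin N)
    (r : ℝ) : ℝ :=
  W (ℓ.toFun r.toNNReal).toNNReal ω p

variable (ℓ : TimeChange) {ω : Ω} {p : Fin N}

lemma continuousWithinAt_timeChanged (hcont : Continuous fun r => W r ω p)
    (r : ℝ) : ContinuousWithinAt (timeChanged W ℓ ω p) (Ici r) r :=
  hcont.continuousAt.comp_continuousWithinAt
    (continuous_real_toNNReal.continuousAt.comp_continuousWithinAt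
      (ℓ.stieltjes.right_continuous r))

lemma exists_bound_timeChanged (hcont : Continuous fun r => W r ω p)
    (b : ℝ) : ∃ C, ∀ r ≤ b, |timeChanged W ℓ ω p r| ≤ C := by
  obtain ⟨C, hC⟩ := (isCompact_Icc (a := (0 : ℝ≥0))
    (b := (ℓ.toFun b.toNNReal).toNNReal)).exists_bound_of_continuousOn hcont.continuousOn
  exact ⟨C, fun r hr => hC _ ⟨zero_le, Real.toNNReal_le_toNNReal
    (ℓ.strictMono.monotone (Real.toNNReal_le_toNNReal hr))⟩⟩

end TimeChanged

section Brownian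

variable {N : ℕ} {Ω : Type*} [MeasurableSpace Ω] {P : Measure Ω}
  {W : ℝ≥0 → Ω → EuclideanSpace ℝ (Fin N)}

lemma IsBrownianVector.measurable_apply (hW : IsBrownianVector W P) (r : ℝ≥0) (p : Fin N) :
    Measurable fun ω => W r ω p :=
  (EuclideanSpace.proj (𝕜 := ℝ) p).continuous.measurable.comp (hW.measurable r)

lemma IsBrownianVector.iIndepFun_increments (hW : IsBrownianVector W P) {u : ℕ → ℝ≥0}
    (hu : Monotone u) {ι : Type*} {e : ι → ℕ} (he : Function.Injective e) :
    iIndepFun (fun (k : Fin N × ι) ω => W (u (e k.2 + 1)) ω k.1 - W (u (e k.2)) ω k.1) P := by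
  refine iIndepFun_uncurry' (X := fun p k ω => W (u (e k + 1)) ω p - W (u (e k)) ω p)
    (fun p k => (hW.measurable_apply _ p).sub (hW.measurable_apply _ p)) ?_ fun p => ?_
  · exact hW.indep.comp (fun _ path k => path (u (e k + 1)) - path (u (e k)))
      fun _ => measurable_pi_lambda _ fun k => by fun_prop
  · exact ((hW.brownian p).hasIndepIncrements.nat hu).precomp he

lemma IsBrownianVector.charFun_increment (hW : IsBrownianVector W P) {r r' : ℝ≥0} (hr : r ≤ r')
    (p : Fin N) (c : ℝ) :
    charFun (P.map fun ω => W r' ω p - W r ω p) c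
      = Complex.exp ((-(c ^ 2 * ((r' : ℝ) - r)) / 2 : ℝ)) := by
  have hlaw := ((hW.brownian p).hasLaw_sub r' r).map_eq
  have hvar : ((nndist r'.1 r.1 : ℝ≥0) : ℝ) = (r' : ℝ) - r := by
    rw [coe_nndist, Real.dist_eq]
    exact abs_of_nonneg (sub_nonneg.2 (NNReal.coe_le_coe.2 hr))
  refine (congrArg (charFun · c) hlaw).trans ?_
  rw [charFun_gaussianReal, hvar]
  push_cast
  ring_nf

theorem IsBrownianVector.integral_cexp_increments [IsProbabilityMeasure P]
    (hW : IsBrownianVector W P) {u : ℕ → ℝ≥0} (hu : Monotone u) {ι : Type*} [Fintype ι] {e : ι → ℕ}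
    (he : Function.Injective e) (d : Fin N × ι → ℝ) :
    ∫ ω, Complex.exp (((∑ k, d k * (W (u (e k.2 + 1)) ω k.1 - W (u (e k.2)) ω k.1) : ℝ) : ℂ)
        * Complex.I) ∂P
      = Complex.exp ((-(∑ k, d k ^ 2 * ((u (e k.2 + 1) : ℝ) - u (e k.2))) / 2 : ℝ)) := by
  have hm : ∀ k : Fin N × ι,
      Measurable fun ω => W (u (e k.2 + 1)) ω k.1 - W (u (e k.2)) ω k.1 := fun k =>
    (hW.measurable_apply _ _).sub (hW.measurable_apply _ _)
  have hprod := (iIndepFun_iff_charFun_pi fun k => (hm k).aemeasurable).1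
    (hW.iIndepFun_increments hu he) (WithLp.toLp 2 d)
  simp only [hW.charFun_increment (hu (Nat.le_add_right _ 1))] at hprod
  have hm' : Measurable fun ω => WithLp.toLp 2 fun k : Fin N × ι =>
      W (u (e k.2 + 1)) ω k.1 - W (u (e k.2)) ω k.1 :=
    (PiLp.continuous_toLp 2 _).measurable.comp (measurable_pi_lambda _ hm)
  rw [charFun_apply, integral_map hm'.aemeasurable (by fun_prop), ← Complex.exp_sum] at hprod
  simp only [PiLp.inner_apply, RCLike.inner_apply, conj_trivial] at hprod
  rw [hprod, ← Complex.ofReal_sum, ← Finset.sum_div, Finset.sum_neg_distrib]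

variable (ℓ : TimeChange) {θ : ℕ → ℝ}

lemma sum_riemannStieltjesSum_eq {M n : ℕ} (g : Fin M → Fin N → ℝ → ℝ) (w : Fin N → ℝ → ℝ) :
    ∑ j, ∑ p, riemannStieltjesSum (g j p) (w p) (θ j) (θ (j + 1)) n
      = ∑ k : Fin N × Fin M × Fin n, g k.2.1 k.1 (refGrid θ n (finProdFinEquiv k.2))
        * (w k.1 (refGrid θ n (finProdFinEquiv k.2 + 1))
          - w k.1 (refGrid θ n (finProdFinEquiv k.2))) := by
  rw [Finset.sum_comm, Fintype.sum_prod_type]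
  refine Finset.sum_congr rfl fun p _ => ?_
  rw [Fintype.sum_prod_type]
  refine Finset.sum_congr rfl fun j _ => ?_
  rw [riemannStieltjesSum, Finset.sum_range]
  refine Finset.sum_congr rfl fun l _ => ?_
  rw [finProdFinEquiv_apply_val, refGrid_eq θ _ l.2, refGrid_succ_eq θ _ l.2]

theorem IsBrownianVector.integral_cexp_riemannStieltjesSum [IsProbabilityMeasure P]
    (hW : IsBrownianVector W P) (hθ : Monotone θ) {M n : ℕ} (hn : n ≠ 0)
    (g : Fin M → Fin N → ℝ → ℝ) :
    ∫ ω, Complex.exp (((∑ j, ∑ p, riemannStieltjesSum (g j p) (timeChanged W ℓ ω p)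
        (θ j) (θ (j + 1)) n : ℝ) : ℂ) * Complex.I) ∂P
      = Complex.exp ((-(∑ j, ∑ p, riemannStieltjesSum (fun r => g j p r ^ 2) ℓ.stieltjes
          (θ j) (θ (j + 1)) n) / 2 : ℝ)) := by
  have hu : Monotone fun k => (ℓ.toFun (refGrid θ n k).toNNReal).toNNReal := fun k k' hk =>
    Real.toNNReal_le_toNNReal
      (ℓ.strictMono.monotone (Real.toNNReal_le_toNNReal (refGrid_mono hθ hn hk)))
  have hcoe : ∀ r, ((ℓ.toFun (Real.toNNReal r)).toNNReal : ℝ) = ℓ.stieltjes r := fun r =>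
    Real.coe_toNNReal _ (ℓ.nonneg _)
  have hchar := hW.integral_cexp_increments hu
    (Fin.val_injective.comp (finProdFinEquiv (m := M) (n := n)).injective)
    fun k => g k.2.1 k.1 (refGrid θ n (finProdFinEquiv k.2))
  simp only [hcoe, Function.comp_apply] at hchar
  simp only [sum_riemannStieltjesSum_eq]
  exact hchar

theorem IsBrownianVector.integral_cexp_of_tendsto [IsProbabilityMeasure P]
    (hW : IsBrownianVector W P) {M : ℕ} (hθ : Monotone θ) (hθs : ∀ j < M, θ j < θ (j + 1))
    {g : Fin M → Fin N → ℝ → ℝ} (hg : ∀ j p, Continuous (g j p)) {X : Fin M → Fin N → Ω → ℝ}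
    (hX : ∀ᵐ ω ∂P, ∀ j p, Tendsto (riemannStieltjesSum (g j p) (timeChanged W ℓ ω p)
      (θ j) (θ (j + 1))) atTop (𝓝 (X j p ω))) :
    ∫ ω, Complex.exp (((∑ j, ∑ p, X j p ω : ℝ) : ℂ) * Complex.I) ∂P
      = Complex.exp ((-(∑ j : Fin M, ∑ p,
          ∫ r in Ioc (θ j) (θ (j + 1)), g j p r ^ 2 ∂ℓ.stieltjes.measure) / 2 : ℝ)) := by
  have hlhs : Tendsto (fun n => ∫ ω, Complex.exp (((∑ j, ∑ p, riemannStieltjesSum (g j p)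
      (timeChanged W ℓ ω p) (θ j) (θ (j + 1)) n : ℝ) : ℂ) * Complex.I) ∂P) atTop
      (𝓝 (∫ ω, Complex.exp (((∑ j, ∑ p, X j p ω : ℝ) : ℂ) * Complex.I) ∂P)) := by
    refine tendsto_integral_of_dominated_convergence (fun _ => 1) (fun n => ?_)
      (integrable_const _) (fun n => Eventually.of_forall fun ω => ?_) ?_
    · have : Measurable fun ω => ∑ j, ∑ p, riemannStieltjesSum (g j p) (timeChanged W ℓ ω p)
          (θ j) (θ (j + 1)) n :=
        Finset.measurable_fun_sum _ fun j _ => Finset.measurable_fun_sum _ fun p _ =>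
          Finset.measurable_fun_sum _ fun l _ =>
            ((hW.measurable_apply _ p).sub (hW.measurable_apply _ p)).const_mul _
      exact Measurable.aestronglyMeasurable (by fun_prop)
    · rw [Complex.norm_exp_ofReal_mul_I]
    · filter_upwards [hX] with ω hω
      exact ((by fun_prop : Continuous fun r : ℝ => Complex.exp ((r : ℂ) * Complex.I)).tendsto
        _).comp (tendsto_finsetSum _ fun j _ => tendsto_finsetSum _ fun p _ => hω j p)
  have hrhs := ((by fun_prop : Continuous fun r : ℝ => Complex.exp ((-r / 2 : ℝ))).tendsto _).comp
    (tendsto_finsetSum Finset.univ fun (j : Fin M) _ => tendsto_finsetSum Finset.univ fun p _ =>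
      tendsto_riemannStieltjesSum_stieltjes (hθs j j.2) ((hg j p).pow 2) ℓ.stieltjes)
  refine tendsto_nhds_unique hlhs (hrhs.congr' ?_)
  filter_upwards [eventually_ne_atTop 0] with n hn
    using (hW.integral_cexp_riemannStieltjesSum ℓ hθ hn g).symm

end Brownian

section OrnsteinUhlenbeck

variable {N : ℕ} {Ω : Type*} [MeasurableSpace Ω] {P : Measure Ω}
  {W : ℝ≥0 → Ω → EuclideanSpace ℝ (Fin N)}
  {α q : Fin N → ℝ} {f : ℝ → EuclideanSpace ℝ (Fin N)} {T a₀ : ℝ} {ℓ : TimeChange}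
  {x : EuclideanSpace ℝ (Fin N)} {z : ℝ → Ω → EuclideanSpace ℝ (Fin N)}

lemma IsOUProcess.ae_apply_eq (hq : ∀ p, 0 ≤ q p) (hf : ContinuousOn f (Icc a₀ T))
    (hz : IsOUProcess (Matrix.diagonal α) (Matrix.diagonal q) f T W P ℓ a₀ x z) :
    ∀ᵐ ω ∂P, ∀ a r, a₀ ≤ a → a ≤ r → r ≤ T → ∀ p, z r ω p = z a ω p
      + (∫ u in a..r, (α p * z u ω p + f u p))
      + (√(q p) * timeChanged W ℓ ω p r - √(q p) * timeChanged W ℓ ω p a) := by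
  filter_upwards [hz.cadlag, hz.eqn] with ω hcad heqn a r ha har hrT p
  have hint : ∀ c d, a₀ ≤ c → c ≤ d → d ≤ T →
      IntervalIntegrable (fun u => act (Matrix.diagonal α) (z u ω) + f u) volume c d := by
    intro c d hc hcd hd
    refine IntervalIntegrable.add ?_ (ContinuousOn.intervalIntegrable ?_)
    · exact ((hcad.mono_Icc hc hd).continuous_comp (continuous_act _)).intervalIntegrable hcd
    · rw [uIcc_of_le hcd]
      exact hf.mono (Icc_subset_Icc hc hd)
  have hsplit : z r ω = z a ω + (∫ u in a..r, (act (Matrix.diagonal α) (z u ω) + f u))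
      + act (sqrtMat (Matrix.diagonal q)) (W (ℓ.toFun r.toNNReal).toNNReal ω
        - W (ℓ.toFun a.toNNReal).toNNReal ω) := by
    rw [heqn r ⟨ha.trans har, hrT⟩, heqn a ⟨ha, har.trans hrT⟩,
      ← intervalIntegral.integral_add_adjacent_intervals (hint _ _ le_rfl ha (har.trans hrT))
        (hint _ _ ha har hrT)]
    simp only [act_eq_toEuclideanCLM, map_sub]
    abel
  have hproj := (EuclideanSpace.proj (𝕜 := ℝ) p).intervalIntegral_comp_comm
    (hint a r ha har hrT)
  simp only [PiLp.proj_apply, PiLp.add_apply, act_diagonal_apply] at hproj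
  rw [hproj, hsplit]
  simp only [PiLp.add_apply, sqrtMat_diagonal hq, act_diagonal_apply, PiLp.sub_apply, mul_sub,
    timeChanged]

theorem IsOUProcess.ae_tendsto_riemannStieltjesSum (hW : IsBrownianVector W P)
    (hq : ∀ p, 0 ≤ q p) (hf : ContinuousOn f (Icc a₀ T))
    (hz : IsOUProcess (Matrix.diagonal α) (Matrix.diagonal q) f T W P ℓ a₀ x z) :
    ∀ᵐ ω ∂P, ∀ a b, a₀ ≤ a → a < b → b ≤ T → ∀ p,
      Tendsto (riemannStieltjesSum (fun r => √(q p) * Real.exp (α p * (b - r)))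
        (timeChanged W ℓ ω p) a b) atTop
        (𝓝 ((z b ω - act (expMat (Matrix.diagonal α) (b - a)) (z a ω)
          - driftInt (Matrix.diagonal α) f a b) p)) := by
  filter_upwards [hz.cadlag, hz.ae_apply_eq hq hf, ae_all_iff.2 fun p => (hW.brownian p).cont]
    with ω hcad heqn hcont a b ha hab hbT p
  have hzp : IsCadlagOn (fun r => z r ω p) (Icc a b) :=
    (hcad.mono_Icc ha hbT).continuous_comp (EuclideanSpace.proj (𝕜 := ℝ) p).continuous
  have hfab : ContinuousOn f (Icc a b) := hf.mono (Icc_subset_Icc ha hbT)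
  obtain ⟨C, hC⟩ := exists_bound_timeChanged ℓ (hcont p) b
  have hlim := tendsto_riemannStieltjesSum_by_parts hab
    (fun r => (hasDerivAt_exp_mul_sub (α p) b r).const_mul √(q p)) (by fun_prop)
    (fun r _ => (continuousWithinAt_timeChanged ℓ (hcont p) r).mono inter_subset_right)
    fun r hr => hC r hr.2
  have hduhamel := linearEquation_increment (w := fun r => √(q p) * timeChanged W ℓ ω p r) hab.le
    (fun r hr => (hzp r hr).1) (hzp.intervalIntegrable hab.le)
    (((EuclideanSpace.proj (𝕜 := ℝ) p).continuous).comp_continuousOn hfab)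
    fun r hr => heqn a r ha hr.1 (hr.2.trans hbT) p
  convert hlim using 2
  rw [PiLp.sub_apply, PiLp.sub_apply, driftInt_diagonal_apply α hab.le hfab, expMat_diagonal,
    act_diagonal_apply]
  refine hduhamel.trans ?_
  rw [sub_self, mul_zero, Real.exp_zero, mul_one, ← mul_sub, sub_eq_add_neg (√(q p) * _),
    ← intervalIntegral.integral_neg]
  congr 2
  ext r
  ring

lemma IsOUProcess.measurable_normIncr {A Q : Matrix (Fin N) (Fin N) ℝ}
    (hz : IsOUProcess A Q f T W P ℓ a₀ x z) {a b : ℝ} (ha : a₀ ≤ a) (hab : a ≤ b) (hbT : b ≤ T) :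
    Measurable fun ω => normIncr A Q f ℓ (fun r => z r ω) a b := by
  refine (continuous_act _).measurable.comp (Measurable.sub_const (Measurable.sub ?_ ?_) _)
  · exact hz.measurable b ⟨ha.trans hab, hbT⟩
  · exact (continuous_act _).measurable.comp (hz.measurable a ⟨ha, hab.trans hbT⟩)

lemma inner_normIncr_diagonal (hq : ∀ p, 0 < q p) {a b : ℝ} (ha : 0 ≤ a) (hab : a < b)
    (ζ : ℝ → EuclideanSpace ℝ (Fin N)) (c : EuclideanSpace ℝ (Fin N)) :
    ⟪normIncr (Matrix.diagonal α) (Matrix.diagonal q) f ℓ ζ a b, c⟫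
      = ∑ p, c p * (√(covDiag α q ℓ a b p))⁻¹
        * (ζ b - act (expMat (Matrix.diagonal α) (b - a)) (ζ a)
          - driftInt (Matrix.diagonal α) f a b) p := by
  rw [normIncr, covMat_diagonal, invSqrtMat_diagonal (covDiag_pos α hq ℓ ha hab),
    PiLp.inner_apply]
  refine Finset.sum_congr rfl fun p _ => ?_
  rw [act_diagonal_apply, RCLike.inner_apply, conj_trivial, mul_assoc]

lemma sum_setIntegral_sq_eq_norm_sq (hq : ∀ p, 0 < q p) {a b : ℝ} (ha : 0 ≤ a) (hab : a < b)
    (c : EuclideanSpace ℝ (Fin N)) :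
    ∑ p, ∫ r in Ioc a b, (c p * (√(covDiag α q ℓ a b p))⁻¹
      * (√(q p) * Real.exp (α p * (b - r)))) ^ 2 ∂ℓ.stieltjes.measure = ‖c‖ ^ 2 := by
  rw [EuclideanSpace.norm_sq_eq]
  refine Finset.sum_congr rfl fun p _ => ?_
  have hpos := covDiag_pos α hq ℓ ha hab p
  simp only [mul_pow, integral_const_mul, Real.sq_sqrt (hq p).le, inv_pow, Real.sq_sqrt hpos.le]
  rw [Real.norm_eq_abs, sq_abs, mul_assoc, ← integral_const_mul]
  exact (congrArg _ (inv_mul_cancel₀ hpos.ne')).trans (mul_one _)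

theorem IsOUProcess.map_normIncr [IsProbabilityMeasure P] (hW : IsBrownianVector W P)
    (hq : ∀ p, 0 < q p) (ha₀ : 0 ≤ a₀) (hf : ContinuousOn f (Icc a₀ T))
    (hz : IsOUProcess (Matrix.diagonal α) (Matrix.diagonal q) f T W P ℓ a₀ x z)
    {θ : ℕ → ℝ} {M : ℕ} (hθ : Monotone θ) (hθs : ∀ j < M, θ j < θ (j + 1)) (hθ0 : a₀ ≤ θ 0)
    (hθT : θ M ≤ T) :
    P.map (fun ω (j : Fin M) => normIncr (Matrix.diagonal α) (Matrix.diagonal q) f ℓ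
        (fun r => z r ω) (θ j) (θ (j + 1)))
      = Measure.pi fun _ => stdGaussian (EuclideanSpace ℝ (Fin N)) := by
  have hθa : ∀ j, a₀ ≤ θ j := fun j => hθ0.trans (hθ j.zero_le)
  have hθb : ∀ j : Fin M, θ (j + 1) ≤ T := fun j => (hθ j.2).trans hθT
  refine map_eq_pi_stdGaussian
    (fun j => hz.measurable_normIncr (hθa j) (hθs j j.2).le (hθb j)) fun c => ?_
  simp only [fun j : Fin M => fun ω => inner_normIncr_diagonal (α := α) (f := f) (ℓ := ℓ) hq
    (ha₀.trans (hθa j)) (hθs j j.2) (fun r => z r ω) (c j)]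
  rw [hW.integral_cexp_of_tendsto ℓ hθ hθs (g := fun j p r => c j p
    * (√(covDiag α q ℓ (θ j) (θ (j + 1)) p))⁻¹ * (√(q p) * Real.exp (α p * (θ (j + 1) - r))))
    (fun j p => by fun_prop)]
  · simp only [fun j : Fin M => sum_setIntegral_sq_eq_norm_sq (α := α) (ℓ := ℓ) hq
      (ha₀.trans (hθa j)) (hθs j j.2) (c j)]
  · filter_upwards [hz.ae_tendsto_riemannStieltjesSum hW (fun p => (hq p).le) hf] with ω hω j p
    refine ((hω _ _ (hθa j) (hθs j j.2) (hθb j) p).const_mul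
      (c j p * (√(covDiag α q ℓ (θ j) (θ (j + 1)) p))⁻¹)).congr fun n => ?_
    simp only [riemannStieltjesSum, Finset.mul_sum, mul_assoc]

end OrnsteinUhlenbeck

section PathWeight

variable {S E : Type*}

/-- The weight `u(y₀) ∏_{j < M} q_j(y_{j+1}, g_j)` of the path that descends from `y_M = y` by
`y_j = Ψ_j(y_{j+1}, g_j)`, as a function of its starting point `y` and of its noise `g`. -/
def pathWeight (Ψ : ℕ → S → E → S) (q : ℕ → S → E → ℝ) (u : S → ℝ) :
    (M : ℕ) → S → (Fin M → E) → ℝ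
  | 0, y, _ => u y
  | M + 1, y, g =>
    pathWeight Ψ q u M (Ψ M y (g (Fin.last M))) (Fin.init g) * q M y (g (Fin.last M))

variable {Ψ : ℕ → S → E → S} {q : ℕ → S → E → ℝ} {u : S → ℝ} {M : ℕ}

lemma pathWeight_eq_mul_prod {Y : ℕ → S} {g : ℕ → E} (hY : ∀ j < M, Y j = Ψ j (Y (j + 1)) (g j)) :
    pathWeight Ψ q u M (Y M) (fun j => g j)
      = u (Y 0) * ∏ j ∈ Finset.range M, q j (Y (j + 1)) (g j) := by
  induction M with
  | zero => rw [pathWeight, Finset.prod_range_zero, mul_one]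
  | succ M ih =>
    rw [pathWeight, Finset.prod_range_succ, ← mul_assoc, ← ih fun j hj => hY j (by lia),
      hY M M.lt_succ_self]
    rfl

variable {m : ℕ} {C : ℝ} {ρ : ℕ → E → ℝ}

lemma abs_pathWeight_le (hu : ∀ y, |u y| ≤ C) (hqρ : ∀ j < M, ∀ y g, |q j y g| ≤ ρ j g)
    (hm : m ≤ M) (y : S) (g : Fin m → E) :
    |pathWeight Ψ q u m y g| ≤ C * ∏ j : Fin m, ρ j (g j) := by
  induction m generalizing y with
  | zero => simpa [pathWeight] using hu y
  | succ m ih =>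
    have hprev := ih (Nat.le_of_succ_le hm) (Ψ m y (g (Fin.last m))) (Fin.init g)
    rw [pathWeight, abs_mul, Fin.prod_univ_castSucc, ← mul_assoc]
    exact mul_le_mul hprev (hqρ m hm _ _) (abs_nonneg _) ((abs_nonneg _).trans hprev)

variable [MeasurableSpace S] [MeasurableSpace E]

/-- For noise of law `γ`, the conditions under which `pathWeight Ψ q u m` can be integrated over
the noise, for `m ≤ M`. -/
structure IsDominatedRecursion (Ψ : ℕ → S → E → S) (q : ℕ → S → E → ℝ) (u : S → ℝ)
    (γ : Measure E) (M : ℕ) : Prop where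
  measurable_step : ∀ j < M, Measurable (Ψ j).uncurry
  measurable_weight : ∀ j < M, Measurable (q j).uncurry
  dominated_weight : ∀ j < M, ∃ ρ, Integrable ρ γ ∧ ∀ y g, |q j y g| ≤ ρ g
  measurable_terminal : Measurable u
  bounded_terminal : ∃ C, ∀ y, |u y| ≤ C

namespace IsDominatedRecursion

variable {γ : Measure E}

lemma measurable_pathWeight (h : IsDominatedRecursion Ψ q u γ M) (hm : m ≤ M) :
    Measurable (pathWeight Ψ q u m).uncurry := by
  induction m with
  | zero => exact h.measurable_terminal.comp measurable_fst
  | succ m ih =>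
    have hlast : Measurable fun z : S × (Fin (m + 1) → E) => (z.1, z.2 (Fin.last m)) := by fun_prop
    have hinit : Measurable fun z : S × (Fin (m + 1) → E) => Fin.init z.2 :=
      measurable_pi_lambda _ fun j => by unfold Fin.init; fun_prop
    exact ((ih (Nat.le_of_succ_le hm)).comp
      (((h.measurable_step m hm).comp hlast).prodMk hinit)).mul
      ((h.measurable_weight m hm).comp hlast)

variable [SigmaFinite γ]

lemma exists_integrable_bound (h : IsDominatedRecursion Ψ q u γ M) (hm : m ≤ M) :
    ∃ D : (Fin m → E) → ℝ, Integrable D (Measure.pi fun _ => γ) ∧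
      ∀ y g, |pathWeight Ψ q u m y g| ≤ D g := by
  obtain ⟨C, hC⟩ := h.bounded_terminal
  choose! ρ hρ using h.dominated_weight
  exact ⟨fun g => C * ∏ j : Fin m, ρ j (g j),
    (Integrable.fintype_prod fun j : Fin m => (hρ j (j.2.trans_le hm)).1).const_mul C,
    abs_pathWeight_le hC (fun j hj => (hρ j hj).2) hm⟩

lemma integrable_pathWeight_comp (h : IsDominatedRecursion Ψ q u γ M) (hm : m ≤ M) {Ω : Type*}
    [MeasurableSpace Ω] {P : Measure Ω} {X : Ω → S} (hX : Measurable X) {V : Ω → Fin m → E}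
    (hV : MeasurePreserving V P (Measure.pi fun _ => γ)) :
    Integrable (fun ω => pathWeight Ψ q u m (X ω) (V ω)) P := by
  obtain ⟨D, hD, hle⟩ := h.exists_integrable_bound hm
  exact (hV.integrable_comp_of_integrable hD).mono'
    ((h.measurable_pathWeight hm).comp (hX.prodMk hV.measurable)).aestronglyMeasurable
    (Eventually.of_forall fun ω => hle _ _)

lemma measurable_integral_pathWeight (h : IsDominatedRecursion Ψ q u γ M) (hm : m ≤ M) :
    Measurable fun y => ∫ g, pathWeight Ψ q u m y g ∂(Measure.pi fun _ => γ) :=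
  (h.measurable_pathWeight hm).stronglyMeasurable.integral_prod_right.measurable

lemma exists_abs_integral_pathWeight_le (h : IsDominatedRecursion Ψ q u γ M) (hm : m ≤ M) :
    ∃ C, ∀ y, |∫ g, pathWeight Ψ q u m y g ∂(Measure.pi fun _ => γ)| ≤ C := by
  obtain ⟨D, hD, hle⟩ := h.exists_integrable_bound hm
  refine ⟨∫ g, D g ∂(Measure.pi fun _ => γ), fun y => ?_⟩
  rw [← Real.norm_eq_abs]
  exact norm_integral_le_of_norm_le hD (Eventually.of_forall (hle y))

theorem integral_pathWeight_succ (h : IsDominatedRecursion Ψ q u γ M) (hm : m < M) (y : S) :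
    ∫ g, pathWeight Ψ q u (m + 1) y g ∂(Measure.pi fun _ => γ)
      = ∫ a, (∫ g, pathWeight Ψ q u m (Ψ m y a) g ∂(Measure.pi fun _ => γ)) * q m y a ∂γ := by
  have hsplit := (measurePreserving_piFinSuccAbove (fun _ => γ) (Fin.last m)).symm
  have hint := h.integrable_pathWeight_comp hm (measurable_const (a := y)) hsplit
  refine (hsplit.integral_comp' _).symm.trans ((integral_prod _ hint).trans ?_)
  simp only [pathWeight, MeasurableEquiv.piFinSuccAbove_symm_apply, Fin.insertNthEquiv_last,
    Fin.snocEquiv, Equiv.coe_fn_mk, Fin.snoc_last, Fin.init_snoc, integral_mul_const]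

end IsDominatedRecursion

end PathWeight

section Freezing

variable {Ω S E : Type*} [MeasurableSpace Ω] [MeasurableSpace S] [MeasurableSpace E]
  {P : Measure Ω} {X : Ω → S}

lemma condExp_of_measurePreserving_prod [StandardBorelSpace E] [Nonempty E] [IsFiniteMeasure P]
    {V : Ω → E} {ν : Measure E} [IsFiniteMeasure ν]
    (hXV : MeasurePreserving (fun ω => (X ω, V ω)) P ((P.map X).prod ν)) {φ : S → E → ℝ}
    (hφ : Measurable φ.uncurry) (hint : Integrable (fun ω => φ (X ω) (V ω)) P) :
    P[fun ω => φ (X ω) (V ω) | MeasurableSpace.comap X inferInstance]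
      =ᵐ[P] fun ω => ∫ v, φ (X ω) v ∂ν := by
  have hX : Measurable X := measurable_fst.comp hXV.measurable
  have hV : Measurable V := measurable_snd.comp hXV.measurable
  have hcond : condDistrib V X P =ᵐ[P.map X] Kernel.const S ν :=
    condDistrib_ae_eq_of_measure_eq_compProd X hV.aemeasurable
      (hXV.map_eq.trans Measure.compProd_const.symm)
  filter_upwards [condExp_prod_ae_eq_integral_condDistrib hX hV.aemeasurable
    hφ.stronglyMeasurable hint, ae_of_ae_map hX.aemeasurable hcond] with ω hω hωκ
  refine hω.trans ?_
  rw [hωκ, Kernel.const_apply]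
  rfl

lemma measurePreserving_last_init {M : ℕ} {γ : Measure E} [SigmaFinite γ] {G : ℕ → Ω → E}
    (hG : MeasurePreserving (fun ω (j : Fin (M + 1)) => G j ω) P (Measure.pi fun _ => γ)) :
    MeasurePreserving (fun ω => (G M ω, fun j : Fin M => G j ω)) P
      (γ.prod (Measure.pi fun _ => γ)) := by
  convert (measurePreserving_piFinSuccAbove (fun _ => γ) (Fin.last M)).comp hG using 1
  funext ω
  simp only [Function.comp_apply, MeasurableEquiv.piFinSuccAbove_apply,
    Fin.insertNthEquiv_last, Fin.snocEquiv_symm_apply]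
  rfl

lemma measurePreserving_prodMk_of_ae_eq_comp {E' : Type*} [MeasurableSpace E'] {γ : Measure E}
    {ν : Measure E'} [IsProbabilityMeasure γ] [IsProbabilityMeasure ν] {U : Ω → E} {V : Ω → E'}
    (hUV : MeasurePreserving (fun ω => (U ω, V ω)) P (γ.prod ν)) {ψ : E → S} (hψ : Measurable ψ)
    (hX : Measurable X) (hXU : X =ᵐ[P] fun ω => ψ (U ω)) :
    MeasurePreserving (fun ω => (X ω, V ω)) P ((P.map X).prod ν) := by
  have hU : MeasurePreserving U P γ := measurePreserving_fst.comp hUV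
  have hV : Measurable V := measurable_snd.comp hUV.measurable
  have hXlaw : P.map X = γ.map ψ := by
    rw [Measure.map_congr hXU, ← hU.map_eq, Measure.map_map hψ hU.measurable]
    rfl
  refine ⟨hX.prodMk hV, ?_⟩
  calc P.map (fun ω => (X ω, V ω))
      = P.map (Prod.map ψ id ∘ fun ω => (U ω, V ω)) :=
        Measure.map_congr (hXU.mono fun ω hω => Prod.ext hω rfl)
    _ = (γ.prod ν).map (Prod.map ψ id) := by
        rw [← hUV.map_eq, Measure.map_map (hψ.prodMap measurable_id) hUV.measurable]
    _ = (P.map X).prod ν := by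
        rw [← Measure.map_prod_map γ ν hψ measurable_id, Measure.map_id, hXlaw]

end Freezing

section BackwardGrid

/-- The times `τ 0 > τ 1 > ⋯ > τ M` in `[a, b]`, listed backwards as in `kIter`. -/
structure IsBackwardGrid (τ : ℕ → ℝ) (M : ℕ) (a b : ℝ) : Prop where
  strictAntiOn : StrictAntiOn τ (Iic M)
  left_le : a ≤ τ M
  le_right : τ 0 ≤ b

namespace IsBackwardGrid

variable {τ : ℕ → ℝ} {M j : ℕ} {a b : ℝ}

lemma succ_lt (hτ : IsBackwardGrid τ M a b) (hj : j < M) : τ (j + 1) < τ j :=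
  hτ.strictAntiOn (mem_Iic.2 hj.le) (mem_Iic.2 hj) j.lt_succ_self

lemma mem_Icc (hτ : IsBackwardGrid τ M a b) (hj : j ≤ M) : τ j ∈ Icc a b :=
  ⟨hτ.left_le.trans (hτ.strictAntiOn.antitoneOn hj self_mem_Iic hj),
    (hτ.strictAntiOn.antitoneOn (mem_Iic.2 zero_le) hj zero_le).trans hτ.le_right⟩

end IsBackwardGrid

lemma isBackwardGrid_reverse {s t T : ℝ} (hs : 0 ≤ s) (htT : t ≤ T) {n i : ℕ} (hi : i ≤ n)
    {ts : ℕ → ℝ} (hts : s ≤ ts (n - i)) (hmono : StrictMonoOn ts (Icc (n - i) (n + 1)))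
    (htn : ts (n + 1) < t) (htl : ts (n + 2) = t) :
    IsBackwardGrid (fun j => ts (n + 2 - j)) (i + 2) 0 T := by
  have hlast : StrictMonoOn ts (Icc (n + 1) (n + 2)) := fun j hj k hk hjk => by
    rwa [(by grind : j = n + 1), (by grind : k = n + 2), htl]
  have hmono' : StrictMonoOn ts (Icc (n - i) (n + 2)) := by
    rw [← Icc_union_Icc_eq_Icc (by lia : n - i ≤ n + 1) (by lia : n + 1 ≤ n + 2)]
    exact hmono.union hlast (isGreatest_Icc (by lia)) (isLeast_Icc (by lia))
  refine ⟨fun j hj k hk hjk => ?_, ?_, htl.trans_le htT⟩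
  · rw [mem_Iic] at hj hk
    exact hmono' ⟨by lia, by lia⟩ ⟨by lia, by lia⟩ (by lia)
  · rw [(by lia : n + 2 - (i + 2) = n - i)]
    exact hs.trans hts

end BackwardGrid

section Transition

variable {N : ℕ} {Ω : Type*} [MeasurableSpace Ω] {P : Measure Ω}
  {W : ℝ≥0 → Ω → EuclideanSpace ℝ (Fin N)} {A Q : Matrix (Fin N) (Fin N) ℝ} {α q : Fin N → ℝ}
  {f : ℝ → EuclideanSpace ℝ (Fin N)} {T a₀ a b : ℝ} {ℓ : TimeChange}
  {x : EuclideanSpace ℝ (Fin N)}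
  {z : ℝ → Ω → EuclideanSpace ℝ (Fin N)}

lemma IsOUProcess.ae_eq_start (hz : IsOUProcess A Q f T W P ℓ a₀ x z) (haT : a₀ ≤ T) :
    ∀ᵐ ω ∂P, z a₀ ω = x := by
  filter_upwards [hz.eqn] with ω hω
  have h := hω a₀ ⟨le_rfl, haT⟩
  rw [intervalIntegral.integral_same, sub_self, add_zero, act_eq_toEuclideanCLM, map_zero,
    add_zero] at h
  exact h

lemma IsOUProcess.ae_eq_transition (hz : IsOUProcess A Q f T W P ℓ a₀ x z) (haT : a₀ ≤ T)
    (hcov : (covMat A Q ℓ a₀ b).PosDef) :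
    z b =ᵐ[P] fun ω => transition A Q f ℓ a₀ b x (normIncr A Q f ℓ (fun r => z r ω) a₀ b) := by
  filter_upwards [hz.ae_eq_start haT] with ω hω
  have h := transition_normIncr hcov f fun r => z r ω
  rw [hω] at h
  exact h.symm

theorem IsOUProcess.measurePreserving_normIncr [IsProbabilityMeasure P]
    (hW : IsBrownianVector W P) (hq : ∀ p, 0 < q p) (ha₀ : 0 ≤ a₀) (hf : ContinuousOn f (Icc a₀ T))
    (hz : IsOUProcess (Matrix.diagonal α) (Matrix.diagonal q) f T W P ℓ a₀ x z)
    {τ : ℕ → ℝ} {M : ℕ} (hτ : IsBackwardGrid τ M a₀ T) :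
    MeasurePreserving (fun ω (j : Fin M) => normIncr (Matrix.diagonal α) (Matrix.diagonal q) f ℓ
        (fun r => z r ω) (τ (j + 1)) (τ j)) P
      (Measure.pi fun _ => stdGaussian (EuclideanSpace ℝ (Fin N))) := by
  have hmem : ∀ l, τ (M - l) ∈ Icc a₀ T := fun l => hτ.mem_Icc (Nat.sub_le _ _)
  have hθ : Monotone fun l => τ (M - l) := fun l l' h =>
    hτ.strictAntiOn.antitoneOn (mem_Iic.2 (Nat.sub_le _ _)) (mem_Iic.2 (Nat.sub_le _ _))
      (Nat.sub_le_sub_left h M)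
  have hθs : ∀ l < M, τ (M - l) < τ (M - (l + 1)) := fun l hl =>
    hτ.strictAntiOn (mem_Iic.2 (Nat.sub_le _ _)) (mem_Iic.2 (Nat.sub_le _ _)) (by lia)
  have hmeas : ∀ l : Fin M, Measurable fun ω => normIncr (Matrix.diagonal α) (Matrix.diagonal q)
      f ℓ (fun r => z r ω) (τ (M - l)) (τ (M - (l + 1))) := fun l =>
    hz.measurable_normIncr (hmem _).1 (hθ l.1.le_succ) (hmem _).2
  have hlaw := hz.map_normIncr hW hq ha₀ hf hθ hθs (hmem 0).1 (hmem M).2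
  have hrev := (measurePreserving_arrowCongr' (fun _ => stdGaussian (EuclideanSpace ℝ (Fin N)))
    (fun _ => stdGaussian (EuclideanSpace ℝ (Fin N))) (Fin.revPerm (n := M)) (.refl _)
    fun _ => .id _).comp ⟨measurable_pi_lambda _ hmeas, hlaw⟩
  convert hrev using 1
  ext ω j : 2
  have hj : M - (Fin.rev j : ℕ) = j + 1 ∧ M - ((Fin.rev j : ℕ) + 1) = j := by
    rw [Fin.val_rev]; lia
  exact (congrArg₂ (normIncr (Matrix.diagonal α) (Matrix.diagonal q) f ℓ fun r => z r ω)
    (congrArg τ hj.1) (congrArg τ hj.2)).symm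

lemma IsOUProcess.integral_comp [IsProbabilityMeasure P] (hW : IsBrownianVector W P)
    (hq : ∀ p, 0 < q p) (ha₀ : 0 ≤ a₀) (hf : ContinuousOn f (Icc a₀ T))
    (hz : IsOUProcess (Matrix.diagonal α) (Matrix.diagonal q) f T W P ℓ a₀ x z) (hab : a₀ < b)
    (hbT : b ≤ T) {h : EuclideanSpace ℝ (Fin N) → ℝ} (hm : Measurable h) :
    ∫ ω, h (z b ω) ∂P = ∫ g, h (transition (Matrix.diagonal α) (Matrix.diagonal q) f ℓ a₀ b x g)
      ∂(stdGaussian (EuclideanSpace ℝ (Fin N))) := by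
  have hτ : IsBackwardGrid (fun j : ℕ => if j = 0 then b else a₀) 1 a₀ T := by
    refine ⟨fun j _ k hk hjk => ?_, by simp, by simpa using hbT⟩
    rw [mem_Iic] at hk
    simpa [(by lia : j = 0), (by lia : k = 1)] using hab
  have hlaw := (measurePreserving_eval (fun _ => stdGaussian (EuclideanSpace ℝ (Fin N)))
    (0 : Fin 1)).comp (hz.measurePreserving_normIncr hW hq ha₀ hf hτ)
  simp only [Function.comp_def, Function.eval, Fin.val_zero, zero_add, one_ne_zero,
    if_true, if_false] at hlaw
  have htrans : Measurable (transition (Matrix.diagonal α) (Matrix.diagonal q) f ℓ a₀ b x) :=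
    (measurable_transition _ _ _ _ _ _).of_uncurry_left
  rw [← hlaw.map_eq, integral_map hlaw.aemeasurable
    (f := fun g => h (transition (Matrix.diagonal α) (Matrix.diagonal q) f ℓ a₀ b x g))
    (hm.comp htrans).aestronglyMeasurable]
  exact integral_congr_ae ((hz.ae_eq_transition (hab.le.trans hbT)
    (posDef_covMat_diagonal α hq ℓ ha₀ hab)).fun_comp h)

lemma IsOUProcess.measurePreserving_prodMk_normIncr [IsProbabilityMeasure P]
    (hW : IsBrownianVector W P) (hq : ∀ p, 0 < q p) (hf : ContinuousOn f (Icc 0 T))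
    {τ : ℕ → ℝ} {M : ℕ} (hτ : IsBackwardGrid τ (M + 1) 0 T)
    (hz : IsOUProcess (Matrix.diagonal α) (Matrix.diagonal q) f T W P ℓ (τ (M + 1)) x z) :
    MeasurePreserving (fun ω => (z (τ M) ω, fun j : Fin M => normIncr (Matrix.diagonal α)
        (Matrix.diagonal q) f ℓ (fun r => z r ω) (τ (j + 1)) (τ j))) P
      ((P.map (z (τ M))).prod (Measure.pi fun _ => stdGaussian (EuclideanSpace ℝ (Fin N)))) := by
  have h0 := (hτ.mem_Icc le_rfl).1
  have hlt := hτ.succ_lt M.lt_succ_self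
  have hG := measurePreserving_last_init
    (G := fun j ω => normIncr (Matrix.diagonal α) (Matrix.diagonal q) f ℓ (fun r => z r ω)
      (τ (j + 1)) (τ j))
    (hz.measurePreserving_normIncr hW hq h0 (hf.mono (Icc_subset_Icc_left h0))
      ⟨hτ.strictAntiOn, le_rfl, hτ.le_right⟩)
  exact measurePreserving_prodMk_of_ae_eq_comp hG
    (measurable_transition _ _ f ℓ (τ (M + 1)) (τ M)).of_uncurry_left
    (hz.measurable _ ⟨hlt.le, (hτ.mem_Icc M.le_succ).2⟩)
    (hz.ae_eq_transition (hτ.mem_Icc le_rfl).2 (posDef_covMat_diagonal α hq ℓ h0 hlt))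

/-- `⟨(I^ℓ_{a,b})^{-1/2} e^{(b-a)A} v, g⟩`, the weight that differentiates the transition from
time `a` to time `b` in the direction `v`. -/
def gradWeight (A Q : Matrix (Fin N) (Fin N) ℝ) (ℓ : TimeChange) (a b : ℝ)
    (v g : EuclideanSpace ℝ (Fin N)) : ℝ :=
  ⟪act (invSqrtMat (covMat A Q ℓ a b)) (act (expMat A (b - a)) v), g⟫

lemma continuous_gradWeight (A Q : Matrix (Fin N) (Fin N) ℝ) (ℓ : TimeChange) (a b : ℝ) :
    Continuous (gradWeight A Q ℓ a b).uncurry :=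
  (((continuous_act _).comp (continuous_act _)).comp continuous_fst).inner continuous_snd

lemma exists_abs_gradWeight_le (A Q : Matrix (Fin N) (Fin N) ℝ) (ℓ : TimeChange) (a b : ℝ) :
    ∃ K, 0 ≤ K ∧ ∀ v g, |gradWeight A Q ℓ a b v g| ≤ K * ‖v‖ * ‖g‖ := by
  let L := Matrix.toEuclideanCLM (𝕜 := ℝ) (invSqrtMat (covMat A Q ℓ a b))
    ∘L Matrix.toEuclideanCLM (𝕜 := ℝ) (expMat A (b - a))
  refine ⟨‖L‖, norm_nonneg _, fun v g => (abs_real_inner_le_norm _ _).trans ?_⟩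
  gcongr
  exact L.le_opNorm v

variable {h : EuclideanSpace ℝ (Fin N) → ℝ} {C : ℝ}

lemma hasFDerivAt_integral_transition (hcov : (covMat A Q ℓ a b).PosDef)
    (f : ℝ → EuclideanSpace ℝ (Fin N)) (hm : Measurable h) (hC : ∀ y, |h y| ≤ C)
    (y : EuclideanSpace ℝ (Fin N)) :
    HasFDerivAt (fun y => ∫ g, h (transition A Q f ℓ a b y g)
        ∂(stdGaussian (EuclideanSpace ℝ (Fin N))))
      ((∫ g, h (transition A Q f ℓ a b y g) • innerSL ℝ g
          ∂(stdGaussian (EuclideanSpace ℝ (Fin N))))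
        ∘L Matrix.toEuclideanCLM (𝕜 := ℝ) (invSqrtMat (covMat A Q ℓ a b))
        ∘L Matrix.toEuclideanCLM (𝕜 := ℝ) (expMat A (b - a))) y := by
  simp only [transition, act_eq_toEuclideanCLM]
  exact hasFDerivAt_integral_affine_stdGaussian hm hC (act_sqrtMat_act_invSqrtMat hcov) _ _ y

theorem inner_gradient_integral_transition (hcov : (covMat A Q ℓ a b).PosDef)
    (f : ℝ → EuclideanSpace ℝ (Fin N)) (hm : Measurable h) (hC : ∀ y, |h y| ≤ C)
    (v y : EuclideanSpace ℝ (Fin N)) :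
    ⟪v, gradient (fun y => ∫ g, h (transition A Q f ℓ a b y g)
        ∂(stdGaussian (EuclideanSpace ℝ (Fin N)))) y⟫
      = ∫ g, h (transition A Q f ℓ a b y g) * gradWeight A Q ℓ a b v g
        ∂(stdGaussian (EuclideanSpace ℝ (Fin N))) := by
  rw [(hasFDerivAt_iff_hasGradientAt.1 (hasFDerivAt_integral_transition hcov f hm hC y)).gradient,
    real_inner_comm, InnerProductSpace.toDual_symm_apply, ContinuousLinearMap.comp_apply,
    integral_smul_innerSL_apply (h := fun g => h (transition A Q f ℓ a b y g))
      (hm.comp (measurable_transition A Q f ℓ a b).of_uncurry_left) fun g => hC _]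
  rfl

end Transition

section Iteration

variable {N : ℕ} {Ω : Type*} [MeasurableSpace Ω] {P : Measure Ω}
  {W : ℝ≥0 → Ω → EuclideanSpace ℝ (Fin N)} {α q : Fin N → ℝ}
  {f : ℝ → EuclideanSpace ℝ (Fin N)} {T : ℝ}
  {B : ℝ → EuclideanSpace ℝ (Fin N) → EuclideanSpace ℝ (Fin N)}
  {u₀ : EuclideanSpace ℝ (Fin N) → ℝ} {ℓ : ℕ → TimeChange} {τ : ℕ → ℝ} {M m : ℕ}

/-- The transition from time `τ (j + 1)` to time `τ j`, with time change `ℓ j`. -/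
def chainStep (A Q : Matrix (Fin N) (Fin N) ℝ) (f : ℝ → EuclideanSpace ℝ (Fin N))
    (ℓ : ℕ → TimeChange) (τ : ℕ → ℝ) (j : ℕ) (y g : EuclideanSpace ℝ (Fin N)) :
    EuclideanSpace ℝ (Fin N) :=
  transition A Q f (ℓ j) (τ (j + 1)) (τ j) y g

/-- The weight that differentiates `chainStep A Q f ℓ τ j` in the direction `B (τ (j + 1)) y`. -/
def chainWeight (A Q : Matrix (Fin N) (Fin N) ℝ)
    (B : ℝ → EuclideanSpace ℝ (Fin N) → EuclideanSpace ℝ (Fin N)) (ℓ : ℕ → TimeChange)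
    (τ : ℕ → ℝ) (j : ℕ) (y g : EuclideanSpace ℝ (Fin N)) : ℝ :=
  gradWeight A Q (ℓ j) (τ (j + 1)) (τ j) (B (τ (j + 1)) y) g

lemma isDominatedRecursion_chain (A Q : Matrix (Fin N) (Fin N) ℝ)
    (f : ℝ → EuclideanSpace ℝ (Fin N)) (ℓ : ℕ → TimeChange)
    (hBm : ∀ j < M, Measurable (B (τ (j + 1)))) (hBb : ∀ j < M, ∃ D, ∀ y, ‖B (τ (j + 1)) y‖ ≤ D)
    (hu₀ : Measurable u₀) (hu₀b : ∃ C, ∀ y, |u₀ y| ≤ C) :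
    IsDominatedRecursion (chainStep A Q f ℓ τ) (chainWeight A Q B ℓ τ) u₀
      (stdGaussian (EuclideanSpace ℝ (Fin N))) M where
  measurable_step j _ := measurable_transition A Q f (ℓ j) (τ (j + 1)) (τ j)
  measurable_weight j hj := by
    have hdir : Measurable fun z : EuclideanSpace ℝ (Fin N) × EuclideanSpace ℝ (Fin N) =>
        (B (τ (j + 1)) z.1, z.2) := ((hBm j hj).comp measurable_fst).prodMk measurable_snd
    simpa only [chainWeight] using!
      (continuous_gradWeight A Q (ℓ j) (τ (j + 1)) (τ j)).measurable.comp hdir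
  dominated_weight j hj := by
    obtain ⟨D, hD⟩ := hBb j hj
    obtain ⟨K, hK0, hK⟩ := exists_abs_gradWeight_le A Q (ℓ j) (τ (j + 1)) (τ j)
    refine ⟨fun g => K * D * ‖g‖, integrable_norm_stdGaussian.const_mul _,
      fun y g => (hK (B (τ (j + 1)) y) g).trans ?_⟩
    exact mul_le_mul_of_nonneg_right (mul_le_mul_of_nonneg_left (hD y) hK0) (norm_nonneg g)
  measurable_terminal := hu₀
  bounded_terminal := hu₀b

lemma pathWeight_normIncr (A Q : Matrix (Fin N) (Fin N) ℝ)
    (f : ℝ → EuclideanSpace ℝ (Fin N))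
    (B : ℝ → EuclideanSpace ℝ (Fin N) → EuclideanSpace ℝ (Fin N))
    (u₀ : EuclideanSpace ℝ (Fin N) → ℝ) (ℓ : ℕ → TimeChange) (τ : ℕ → ℝ) (m : ℕ)
    (ζ : ℝ → EuclideanSpace ℝ (Fin N)) :
    pathWeight (chainStep A Q f ℓ τ) (chainWeight A Q B ℓ τ) u₀ m (ζ (τ m))
        (fun j => normIncr A Q f (ℓ m) ζ (τ (j + 1)) (τ j))
      = u₀ (rescaledState A Q f ℓ τ m ζ 0) * ∏ j ∈ Finset.Icc 1 m,
          gradWeight A Q (ℓ (j - 1)) (τ j) (τ (j - 1)) (B (τ j) (rescaledState A Q f ℓ τ m ζ j))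
            (normIncr A Q f (ℓ m) ζ (τ j) (τ (j - 1))) := by
  have hprod := pathWeight_eq_mul_prod (u := u₀) (q := chainWeight A Q B ℓ τ)
    (Ψ := chainStep A Q f ℓ τ) (g := fun j => normIncr A Q f (ℓ m) ζ (τ (j + 1)) (τ j))
    fun j hj => rescaledState_eq_transition A Q f ℓ τ ζ hj
  rw [rescaledState_self] at hprod
  rw [hprod, ← Finset.Ico_add_one_right_eq_Icc, Finset.prod_Ico_eq_prod_range]
  simp only [add_comm 1, add_tsub_cancel_right]
  rfl

variable {Z : TimeChange → ℝ → EuclideanSpace ℝ (Fin N) → ℝ → Ω → EuclideanSpace ℝ (Fin N)}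
  [IsProbabilityMeasure P]

lemma integral_kIter_eq_integral_transition (hW : IsBrownianVector W P) (hq : ∀ p, 0 < q p)
    (hf : ContinuousOn f (Icc 0 T))
    (hZ : ∀ ℓ a y, 0 ≤ a → a < T →
      IsOUProcess (Matrix.diagonal α) (Matrix.diagonal q) f T W P ℓ a y (Z ℓ a y))
    (hτ : IsBackwardGrid τ M 0 T) (hm : m < M) (hk : Measurable (kIter P Z B u₀ ℓ τ m)) :
    (fun y => ∫ ω, kIter P Z B u₀ ℓ τ m (Z (ℓ m) (τ (m + 1)) y (τ m) ω) ∂P)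
      = fun y => ∫ g, kIter P Z B u₀ ℓ τ m
          (transition (Matrix.diagonal α) (Matrix.diagonal q) f (ℓ m) (τ (m + 1)) (τ m) y g)
        ∂(stdGaussian (EuclideanSpace ℝ (Fin N))) := by
  have h0 := (hτ.mem_Icc (j := m + 1) hm).1
  have hlt := hτ.succ_lt hm
  have hT := (hτ.mem_Icc hm.le).2
  exact funext fun y => (hZ (ℓ m) _ y h0 (hlt.trans_le hT)).integral_comp hW hq h0
    (hf.mono (Icc_subset_Icc_left h0)) hlt hT hk

theorem kIter_eq_integral_pathWeight (hW : IsBrownianVector W P) (hq : ∀ p, 0 < q p)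
    (hf : ContinuousOn f (Icc 0 T))
    (hZ : ∀ ℓ a y, 0 ≤ a → a < T →
      IsOUProcess (Matrix.diagonal α) (Matrix.diagonal q) f T W P ℓ a y (Z ℓ a y))
    (hτ : IsBackwardGrid τ M 0 T)
    (hrec : IsDominatedRecursion (chainStep (Matrix.diagonal α) (Matrix.diagonal q) f ℓ τ)
      (chainWeight (Matrix.diagonal α) (Matrix.diagonal q) B ℓ τ) u₀
      (stdGaussian (EuclideanSpace ℝ (Fin N))) M) (hm : m ≤ M) :
    kIter P Z B u₀ ℓ τ m = fun y => ∫ g, pathWeight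
        (chainStep (Matrix.diagonal α) (Matrix.diagonal q) f ℓ τ)
        (chainWeight (Matrix.diagonal α) (Matrix.diagonal q) B ℓ τ) u₀ m y g
      ∂(Measure.pi fun _ => stdGaussian (EuclideanSpace ℝ (Fin N))) := by
  induction m with
  | zero =>
    funext y
    rw [kIter, Measure.pi_of_empty, integral_dirac, pathWeight]
  | succ m ih =>
    have hk := ih (Nat.le_of_succ_le hm)
    obtain ⟨C, hC⟩ := hrec.exists_abs_integral_pathWeight_le (Nat.le_of_succ_le hm)
    have hmeas := hrec.measurable_integral_pathWeight (Nat.le_of_succ_le hm)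
    have hcov := posDef_covMat_diagonal α hq (ℓ m) (hτ.mem_Icc hm).1 (hτ.succ_lt hm)
    have hbdd : ∀ y, |kIter P Z B u₀ ℓ τ m y| ≤ C := fun y => by rw [hk]; exact hC y
    rw [← hk] at hmeas
    funext y
    rw [hrec.integral_pathWeight_succ hm, kIter,
      integral_kIter_eq_integral_transition hW hq hf hZ hτ hm hmeas]
    beta_reduce
    rw [inner_gradient_integral_transition hcov f hmeas hbdd, hk]
    rfl

section Regularity

variable (hW : IsBrownianVector W P) (hq : ∀ p, 0 < q p) (hf : ContinuousOn f (Icc 0 T))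
  (hZ : ∀ ℓ a y, 0 ≤ a → a < T →
    IsOUProcess (Matrix.diagonal α) (Matrix.diagonal q) f T W P ℓ a y (Z ℓ a y))
  (hτ : IsBackwardGrid τ M 0 T)
  (hrec : IsDominatedRecursion (chainStep (Matrix.diagonal α) (Matrix.diagonal q) f ℓ τ)
    (chainWeight (Matrix.diagonal α) (Matrix.diagonal q) B ℓ τ) u₀
    (stdGaussian (EuclideanSpace ℝ (Fin N))) M)

include hW hq hf hZ hτ hrec

lemma measurable_kIter (hm : m ≤ M) : Measurable (kIter P Z B u₀ ℓ τ m) := by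
  rw [kIter_eq_integral_pathWeight hW hq hf hZ hτ hrec hm]
  exact hrec.measurable_integral_pathWeight hm

lemma exists_abs_kIter_le (hm : m ≤ M) : ∃ C, ∀ y, |kIter P Z B u₀ ℓ τ m y| ≤ C := by
  rw [kIter_eq_integral_pathWeight hW hq hf hZ hτ hrec hm]
  exact hrec.exists_abs_integral_pathWeight_le hm

lemma integrable_kIter_comp (hm : m < M) (y : EuclideanSpace ℝ (Fin N)) :
    Integrable (fun ω => kIter P Z B u₀ ℓ τ m (Z (ℓ m) (τ (m + 1)) y (τ m) ω)) P := by
  have hk := measurable_kIter hW hq hf hZ hτ hrec hm.le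
  obtain ⟨C, hC⟩ := exists_abs_kIter_le hW hq hf hZ hτ hrec hm.le
  have hlt := hτ.succ_lt hm
  have hT := (hτ.mem_Icc hm.le).2
  have hz := (hZ (ℓ m) _ y (hτ.mem_Icc hm).1 (hlt.trans_le hT)).measurable _ ⟨hlt.le, hT⟩
  exact .of_bound (hk.comp hz).aestronglyMeasurable C (Eventually.of_forall fun ω => hC _)

lemma differentiable_integral_kIter (hm : m < M) :
    Differentiable ℝ
      fun y => ∫ ω, kIter P Z B u₀ ℓ τ m (Z (ℓ m) (τ (m + 1)) y (τ m) ω) ∂P := by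
  have hk := measurable_kIter hW hq hf hZ hτ hrec hm.le
  obtain ⟨C, hC⟩ := exists_abs_kIter_le hW hq hf hZ hτ hrec hm.le
  have hcov := posDef_covMat_diagonal α hq (ℓ m) (hτ.mem_Icc hm).1 (hτ.succ_lt hm)
  rw [integral_kIter_eq_integral_transition hW hq hf hZ hτ hm hk]
  exact fun y => (hasFDerivAt_integral_transition hcov f hk hC y).differentiableAt

end Regularity

end Iteration

end OUIter

end

theorem lemma6p1_general {N : ℕ} {Ω : Type*} [MeasurableSpace Ω] (P : Measure Ω)
    [IsProbabilityMeasure P]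
    (W : ℝ≥0 → Ω → EuclideanSpace ℝ (Fin N)) (hW : OUIter.IsBrownianVector W P)
    (α q : Fin N → ℝ) (hq : ∀ p, 0 < q p)
    (T : ℝ) (f : ℝ → EuclideanSpace ℝ (Fin N)) (hf : ContinuousOn f (Icc 0 T))
    (B : ℝ → EuclideanSpace ℝ (Fin N) → EuclideanSpace ℝ (Fin N))
    (hBmeas : ∀ r ∈ Icc 0 T, Measurable (B r)) (hBbdd : ∀ r ∈ Icc 0 T, ∃ C, ∀ y, ‖B r y‖ ≤ C)
    (u₀ : EuclideanSpace ℝ (Fin N) → ℝ) (hu₀ : Measurable u₀) (hu₀bdd : ∃ C, ∀ y, |u₀ y| ≤ C)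
    (Z : OUIter.TimeChange → ℝ → EuclideanSpace ℝ (Fin N) → ℝ → Ω → EuclideanSpace ℝ (Fin N))
    (hZ : ∀ ℓ a x, 0 ≤ a → a < T →
      OUIter.IsOUProcess (Matrix.diagonal α) (Matrix.diagonal q) f T W P ℓ a x (Z ℓ a x))
    (m : ℕ) (τ : ℕ → ℝ) (hτ : OUIter.IsBackwardGrid τ (m + 1) 0 T)
    (ℓ : ℕ → OUIter.TimeChange) (x : EuclideanSpace ℝ (Fin N)) :
    let A := Matrix.diagonal α
    let Q := Matrix.diagonal q
    let k := OUIter.kIter P Z B u₀ ℓ τ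
    let ζ : Ω → ℝ → EuclideanSpace ℝ (Fin N) := fun ω r => Z (ℓ m) (τ (m + 1)) x r ω
    let Y : Ω → ℕ → EuclideanSpace ℝ (Fin N) := fun ω => OUIter.rescaledState A Q f ℓ τ m (ζ ω)
    let Φ : Ω → ℝ := fun ω =>
      u₀ (Y ω 0) * ∏ j ∈ Finset.Icc 1 m,
        OUIter.gradWeight A Q (ℓ (j - 1)) (τ j) (τ (j - 1)) (B (τ j) (Y ω j))
          (OUIter.normIncr A Q f (ℓ m) (ζ ω) (τ j) (τ (j - 1)))
    (∀ j < m,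
      (∀ y, Integrable (fun ω => k j (Z (ℓ j) (τ (j + 1)) y (τ j) ω)) P) ∧
      Differentiable ℝ (fun y => ∫ ω, k j (Z (ℓ j) (τ (j + 1)) y (τ j) ω) ∂P)) ∧
    Integrable Φ P ∧
    (fun ω => k m (Z (ℓ m) (τ (m + 1)) x (τ m) ω)) =ᵐ[P]
      P[Φ | MeasurableSpace.comap (Z (ℓ m) (τ (m + 1)) x (τ m)) inferInstance] := by
  intro A Q k ζ Y Φ
  have hrec := OUIter.isDominatedRecursion_chain (M := m + 1) A Q f ℓ
    (fun j hj => hBmeas _ (hτ.mem_Icc hj)) (fun j hj => hBbdd _ (hτ.mem_Icc hj)) hu₀ hu₀bdd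
  have hk := OUIter.kIter_eq_integral_pathWeight hW hq hf hZ hτ hrec m.le_succ
  have ha := hτ.mem_Icc le_rfl
  have haT := (hτ.succ_lt m.lt_succ_self).trans_le (hτ.mem_Icc m.le_succ).2
  have hz := hZ (ℓ m) (τ (m + 1)) x ha.1 haT
  have hX := hz.measurable (τ m) ⟨(hτ.succ_lt m.lt_succ_self).le, (hτ.mem_Icc m.le_succ).2⟩
  have := Measure.isProbabilityMeasure_map (μ := P) hX.aemeasurable
  have hXV := hz.measurePreserving_prodMk_normIncr hW hq hf hτ
  have hΦ : Φ = fun ω => OUIter.pathWeight (OUIter.chainStep A Q f ℓ τ)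
      (OUIter.chainWeight A Q B ℓ τ) u₀ m (ζ ω (τ m))
      (fun j => OUIter.normIncr A Q f (ℓ m) (ζ ω) (τ (j + 1)) (τ j)) :=
    funext fun ω => (OUIter.pathWeight_normIncr A Q f B u₀ ℓ τ m (ζ ω)).symm
  have hint := hrec.integrable_pathWeight_comp m.le_succ hX (measurePreserving_snd.comp hXV)
  refine ⟨fun j hj =>
    have hj' := hj.trans m.lt_succ_self
    ⟨OUIter.integrable_kIter_comp hW hq hf hZ hτ hrec hj',
      OUIter.differentiable_integral_kIter hW hq hf hZ hτ hrec hj'⟩, ?_⟩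
  rw [hΦ, show k m = _ from hk]
  exact ⟨hint, (OUIter.condExp_of_measurePreserving_prod hXV
    (hrec.measurable_pathWeight m.le_succ) hint).symm⟩

theorem lemma6p1 {N : ℕ} {Ω : Type*} [MeasurableSpace Ω] (P : Measure Ω) [IsProbabilityMeasure P]
    (W : ℝ≥0 → Ω → EuclideanSpace ℝ (Fin N)) (hW : OUIter.IsBrownianVector W P)
    -- the matrices `A = -diag(λ)` and `Q = diag(σ²)`
    (lam sig : Fin N → ℝ) (hlam : ∀ p, 0 < lam p) (hsig : ∀ p, 0 < sig p ^ 2)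
    (A Q : Matrix (Fin N) (Fin N) ℝ) (hA : A = -Matrix.diagonal lam)
    (hQ : Q = Matrix.diagonal fun p => sig p ^ 2)
    (T : ℝ) (f : ℝ → EuclideanSpace ℝ (Fin N)) (hf : ContinuousOn f (Icc 0 T))
    -- the vector field `B = B₀ - f`
    (B₀ B : ℝ → EuclideanSpace ℝ (Fin N) → EuclideanSpace ℝ (Fin N))
    (hB₀cont : ∀ r ∈ Icc 0 T, Continuous (B₀ r))
    (hB₀bdd : ∃ C : ℝ, ∀ r ∈ Icc 0 T, ∀ y, ‖B₀ r y‖ ≤ C)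
    (hB : ∀ r y, B r y = B₀ r y - f r)
    (u₀ : EuclideanSpace ℝ (Fin N) → ℝ) (hu₀ : Measurable u₀) (hu₀bdd : ∃ C : ℝ, ∀ y, |u₀ y| ≤ C)
    -- the Ornstein-Uhlenbeck processes `Z^ℓ(a, x)`
    (Z : OUIter.TimeChange → ℝ → EuclideanSpace ℝ (Fin N) → ℝ → Ω → EuclideanSpace ℝ (Fin N))
    (hZ : ∀ ℓ a x, 0 ≤ a → a < T → OUIter.IsOUProcess A Q f T W P ℓ a x (Z ℓ a x))
    (s t : ℝ) (hs : 0 ≤ s) (hst : s < t) (htT : t ≤ T) (n : ℕ) (hn : 1 ≤ n)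
    (x : EuclideanSpace ℝ (Fin N)) (i : ℕ) (hi : i ≤ n)
    -- the times `s ≤ s_{n-i} < ⋯ < s_{n+1} < t = s_{n+2}`
    (ts : ℕ → ℝ) (hts : s ≤ ts (n - i)) (hmono : StrictMonoOn ts (Icc (n - i) (n + 1)))
    (htn : ts (n + 1) < t) (htl : ts (n + 2) = t)
    (ℓ : ℕ → OUIter.TimeChange) :
    -- backward enumeration, `τ_j = s_{n+2-j}`
    let τ : ℕ → ℝ := fun j => ts (n + 2 - j)
    let k : ℕ → EuclideanSpace ℝ (Fin N) → ℝ := OUIter.kIter P Z B u₀ ℓ τ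
    -- the path `r ↦ Z^{ℓ^{i+1}}_r(s_{n-i}, x)`
    let ζ : Ω → ℝ → EuclideanSpace ℝ (Fin N) := fun ω r => Z (ℓ (i + 1)) (τ (i + 2)) x r ω
    let Y : Ω → ℕ → EuclideanSpace ℝ (Fin N) := fun ω =>
      OUIter.rescaledState A Q f ℓ τ (i + 1) (ζ ω)
    let Φ : Ω → ℝ := fun ω =>
      u₀ (Y ω 0) *
        ∏ j ∈ Finset.Icc 1 (i + 1),
          ⟪OUIter.act (OUIter.invSqrtMat (OUIter.covMat A Q (ℓ (j - 1)) (τ j) (τ (j - 1))))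
              (OUIter.act (OUIter.expMat A (τ (j - 1) - τ j)) (B (τ j) (Y ω j))),
            OUIter.normIncr A Q f (ℓ (i + 1)) (ζ ω) (τ j) (τ (j - 1))⟫
    -- the expectations and gradients that define `k` exist
    (∀ m ≤ i,
      (∀ y, Integrable (fun ω => k m (Z (ℓ m) (τ (m + 1)) y (τ m) ω)) P) ∧
      Differentiable ℝ (fun y => ∫ ω, k m (Z (ℓ m) (τ (m + 1)) y (τ m) ω) ∂P)) ∧
    Integrable Φ P ∧
    (fun ω => k (i + 1) (Z (ℓ (i + 1)) (τ (i + 2)) x (τ (i + 1)) ω)) =ᵐ[P]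
      P[Φ | MeasurableSpace.comap (Z (ℓ (i + 1)) (τ (i + 2)) x (τ (i + 1))) inferInstance] := by
  rw [Matrix.diagonal_neg] at hA
  subst hA hQ
  obtain rfl : B = fun r y => B₀ r y - f r := funext₂ hB
  obtain ⟨C, hC⟩ := hB₀bdd
  obtain ⟨hreg, hrep⟩ := lemma6p1_general P W hW _ _ hsig T f hf _
    (fun r hr => (hB₀cont r hr).measurable.sub_const (f r))
    (fun r hr => ⟨C + ‖f r‖, fun y => (norm_sub_le _ _).trans (add_le_add_left (hC r hr y) _)⟩)
    u₀ hu₀ hu₀bdd Z hZ (i + 1) _ (OUIter.isBackwardGrid_reverse hs htT hi hts hmono htn htl) ℓ x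
  exact ⟨fun m hm => hreg m (Nat.lt_succ_of_le hm), hrep⟩
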